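/- Let $\Bbbk$ be an algebraically closed field and let $\mathcal C$ be a $\Bbbk$-linear braided monoidal category, with $\Bbbk$-bilinear tensor product, which has finite direct sums and is idempotent complete, has finite dimensional morphism spaces, and satisfies $\operatorname{End}(\mathbf 1)=\Bbbk$. An object $X$ has moderate growth if $\dim\operatorname{End}(X^{\otimes n})<n!$ for some $n\in\mathbb N$; a category has moderate growth if all its indecomposable objects do. An indecomposable object $X$ is non-negligible if $\mathbf 1$ is a direct summand of $Y\otimes X$ for some object $Y$, and negligible otherwise. Let $K(\mathcal C)$ be the ring generated by the isomorphism classes $[X]$ of objects of $\mathcal C$, subject to $[\mathbf 1]=1$, $[X\otimes Y]=[X][Y]$, $[X\oplus Y]=[X]+[Y]$, and $[X]=0$ for $X$ negligible. For an endomorphism $f$ of a rigid object $W$ with dual $W^*$, the quantum trace is $\operatorname{Tr}_W(f)=\operatorname{ev}_W\circ c_{W,W^*}\circ(f\otimes \mathrm{id}_{W^*})\circ\operatorname{coev}_W\in\operatorname{End}(\mathbf 1)$, where $c$ is the braiding. A morphism $f:X\to Y$ is negligible if $\operatorname{Tr}_W(b f a)=0$ for all rigid $W$, $a:W\to X$ and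 $b:Y\to W$ (when $X$ is rigid, this says that $\operatorname{Tr}_X(gf)=0$ for all $g:Y\to X$). Suppose that $\mathcal C$ has moderate growth. Then $\mathcal C$ admits a semisimplification $\overline{\mathcal C}$: there are a semisimple braided tensor category $\overline{\mathcal C}$ over $\Bbbk$ (that is, a $\Bbbk$-linear abelian rigid braided monoidal category with bilinear tensor product, finite dimensional morphism spaces and $\operatorname{End}(\mathbf 1)=\Bbbk$, in which every object is a finite direct sum of simple objects) and a $\Bbbk$-linear braided monoidal functor $F:\mathcal C\to\overline{\mathcal C}$ which is full and essentially surjective, such that $F(f)=0$ if and only if $f$ is negligible. Moreover: 1. $\overline{\mathcal C}$ has moderate growth. 2. $X\mapsto F(X)$ induces a bijection from the isomorphism classes of non-negligible objects of $\mathcal C$ to the isomorphism classes of simple objects of $\overline{\mathcal C}$. 3. The classes of the non-negligible objects form a $\mathbb Z$-basis of $K(\mathcal C)$, and $[X]\mapsto[F(X)]$ defines a ring isomorphism from $K(\mathcal C)$ to the Grothendieck ring of $\overline{\mathcal C}$. -/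

import Mathlib

open CategoryTheory CategoryTheory.Limits CategoryTheory.MonoidalCategory

universe w v u v₁ u₁

namespace SemisimplificationPaper

section Objects

variable {C : Type u} [Category.{v} C] [MonoidalCategory C]

/-- The tensor power `X ^ ⊗ n`, bracketed to the left, with `X ^ ⊗ 0 = 𝟙`. -/
def tensorPower (X : C) : ℕ → C
  | 0 => 𝟙_ C
  | n + 1 => tensorPower X n ⊗ X

/-- `X` has moderate growth over `k`: `dim End (X ^ ⊗ n) < n!` for some `n`.
(It is used only where all morphism spaces are known to be finite dimensional.) -/
def HasModerateGrowth (k : Type w) [Field k] [Preadditive C] [Linear k C] (X : C) : Prop :=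
  ∃ n : ℕ, Module.finrank k (tensorPower X n ⟶ tensorPower X n) < n.factorial

/-- A category has moderate growth if all its indecomposable objects do. -/
def CategoryHasModerateGrowth (k : Type w) [Field k] (C : Type u) [Category.{v} C]
    [MonoidalCategory C] [Preadditive C] [Linear k C] [HasBinaryBiproducts C] : Prop :=
  ∀ X : C, Indecomposable X → HasModerateGrowth k X

variable [Preadditive C] [HasBinaryBiproducts C]

/-- `X` is indecomposable and the unit is a direct summand of `Y ⊗ X` for some `Y`.
A direct summand is expressed by a pair `𝟙 ⟶ Y ⊗ X ⟶ 𝟙` with composite the identity; for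
idempotent complete categories this is the same as a direct sum decomposition. -/
def IsNonNegligible (X : C) : Prop :=
  Indecomposable X ∧ ∃ Y : C, Nonempty (Retract (𝟙_ C) (Y ⊗ X))

/-- `X` is indecomposable but not non-negligible. -/
def IsNegligible (X : C) : Prop :=
  Indecomposable X ∧ ¬ IsNonNegligible X

end Objects

section Trace

variable {C : Type u} [Category.{v} C] [MonoidalCategory C] [BraidedCategory C]

/-- The quantum trace of an endomorphism `f` of a rigid object `W` with dual `W'`, as an
endomorphism of the unit:
`𝟙 ⟶ W ⊗ W' ⟶ W ⊗ W' ⟶ W' ⊗ W ⟶ 𝟙` (coevaluation, `f ⊗ id`, braiding, evaluation). Equivalently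
`ev_{W'} ∘ ((u_W ∘ f) ⊗ id) ∘ coev_W` with the Drinfeld isomorphism `u_W` from `W` to its double
dual. It does not depend on the chosen dual. -/
def quantumTrace (W W' : C) [ExactPairing W W'] (f : W ⟶ W) : 𝟙_ C ⟶ 𝟙_ C :=
  ExactPairing.coevaluation W W' ≫ f ▷ W' ≫ (β_ W W').hom ≫ ExactPairing.evaluation W W'

/-- A morphism `f : X ⟶ Y` is negligible if every endomorphism of a rigid object that factors
through `f` has quantum trace zero. If `X` (or `Y`) is itself rigid, cyclicity of the trace turns
this into the usual condition that `Tr (g ∘ f) = 0` for all `g : Y ⟶ X`. -/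
def IsNegligibleMorphism [Preadditive C] {X Y : C} (f : X ⟶ Y) : Prop :=
  ∀ (W W' : C) [ExactPairing W W'] (a : W ⟶ X) (b : Y ⟶ W),
    quantumTrace W W' (a ≫ f ≫ b) = 0

end Trace

section Rings

variable (C : Type u) [Category.{v} C] [MonoidalCategory C] [BraidedCategory C]

/-- The free abelian group on the isomorphism classes of objects, with the multiplication
induced by the tensor product. -/
abbrev IsoClassRing : Type u := MonoidAlgebra ℤ (Skeleton C)

variable {C} in
/-- The isomorphism class of `X` as an element of the free ring on isomorphism classes. -/
noncomputable def isoClass (X : C) : IsoClassRing C :=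
  MonoidAlgebra.of ℤ (Skeleton C) (toSkeleton X)

/-- The relations of `K(C)`: additivity on direct sums (the relations of the Green ring), and the
vanishing of the classes of the negligible indecomposable objects. -/
def greenRelations [Preadditive C] [HasBinaryBiproducts C] : Set (IsoClassRing C) :=
  {x | ∃ X Y : C, x = isoClass (X ⊞ Y) - isoClass X - isoClass Y} ∪
    {x | ∃ X : C, IsNegligible X ∧ x = isoClass X}

/-- The ring `K(C)`: the Green ring of `C` modulo the ideal of negligible objects. -/
abbrev KRing [Preadditive C] [HasBinaryBiproducts C] : Type u :=
  IsoClassRing C ⧸ Ideal.span (greenRelations C)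

variable {C} in
/-- The class of an object in `K(C)`. -/
noncomputable def KRing.cls [Preadditive C] [HasBinaryBiproducts C] (X : C) : KRing C :=
  Ideal.Quotient.mk _ (isoClass X)

/-- The isomorphism classes of non-negligible objects. -/
def NonNegligibleClass [Preadditive C] [HasBinaryBiproducts C] : Type u :=
  {s : Skeleton C // IsNonNegligible ((fromSkeleton C).obj s)}

/-- The relations of the Grothendieck ring: additivity on short exact sequences. -/
def exactRelations [Abelian C] : Set (IsoClassRing C) :=
  {x | ∃ S : ShortComplex C, S.ShortExact ∧
    x = isoClass S.X₂ - isoClass S.X₁ - isoClass S.X₃}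

/-- The Grothendieck ring of an abelian braided monoidal category (meant for biexact tensor
products, where the ideal spanned by the relations is already the subgroup spanned by them). -/
abbrev GrothendieckRing [Abelian C] : Type u :=
  IsoClassRing C ⧸ Ideal.span (exactRelations C)

variable {C} in
/-- The class of an object in the Grothendieck ring. -/
noncomputable def GrothendieckRing.cls [Abelian C] (X : C) : GrothendieckRing C :=
  Ideal.Quotient.mk _ (isoClass X)

end Rings

attribute [local instance] Abelian.hasFiniteBiproducts

/-- A semisimple tensor category over `k`: a `k`-linear abelian rigid monoidal category with
bilinear tensor product and finite dimensional morphism spaces, in which `End(𝟙) = k` and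
every object is a finite direct sum of simple objects (in particular has finite length). -/
structure IsSemisimpleTensorCategory (k : Type w) [Field k] (D : Type u) [Category.{v} D]
    [Abelian D] [Linear k D] [MonoidalCategory D] : Prop where
  [monoidalPreadditive : MonoidalPreadditive D]
  [monoidalLinear : MonoidalLinear k D]
  finite_hom : ∀ X Y : D, Module.Finite k (X ⟶ Y)
  end_unit : Function.Bijective fun c : k => c • 𝟙 (𝟙_ D)
  rigid : Nonempty (RigidCategory D)
  semisimple : ∀ X : D, ∃ (n : ℕ) (S : Fin n → D),
    (∀ i, Simple (S i)) ∧ Nonempty (X ≅ ⨁ S)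

/-- The braided monoidal functor `F` exhibits `D` as a semisimplification of `C`, that is, as the
quotient of `C` by its negligible morphisms: `F` is `k`-linear, full and essentially surjective and
it kills exactly the negligible morphisms, and `D` is a semisimple tensor category. -/
structure IsSemisimplification (k : Type w) [Field k] {C : Type u} [Category.{v} C]
    [Preadditive C] [Linear k C] [MonoidalCategory C] [BraidedCategory C]
    {D : Type u₁} [Category.{v₁} D] [Abelian D] [Linear k D] [MonoidalCategory D]
    [BraidedCategory D] (F : C ⥤ D) [F.Braided] : Prop where
  additive : F.Additive
  linear : F.Linear k
  full : F.Full
  essSurj : F.EssSurj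
  map_eq_zero_iff : ∀ {X Y : C} (f : X ⟶ Y), F.map f = 0 ↔ IsNegligibleMorphism f
  tensorCategory : IsSemisimpleTensorCategory k D

end SemisimplificationPaper

open SemisimplificationPaper

/-!
# Semisimplification of braided categories of moderate growth

A morphism `f : A ⟶ B` is called null if every composite `𝟙 ⟶ A ⊗ Y ⟶ B ⊗ Y ⟶ 𝟙` through `f ⊗ Y`
vanishes. Null morphisms form a tensor ideal without any assumption on duals, and the
semisimplification is the quotient `NullQuotient C` by this ideal.

The heart of the matter is `exists_exactPairing_and_isNull`: an indecomposable object `X` of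
moderate growth whose identity is not null has a dual, and its non-invertible endomorphisms are
null. To see this, choose a non-null endomorphism `f` of `X` whose composites `f ≫ g` with
non-invertible `g` are all null (`exists_socle`); since `f` is not null, it has a closure
`𝟙 ⟶ X ⊗ Y ⟶ X ⊗ Y ⟶ 𝟙` equal to `1`. Joining `f`, the coevaluation, the braiding and the evaluation
of this closure gives a zigzag `z : X ⟶ X`. If `z` is not invertible, then `f ≫ z` is null. Now take
a linear combination of the positive braids that lift the `n!` permutations of `X ^ ⊗ n`, compose it
with `f ^ ⊗ n`, and close its last strand: a braid whose permutation moves the last point turns into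
a zigzag, which is null, and a braid whose permutation fixes the last point loses that strand. So by
induction the `n!` braids are linearly independent (`factorial_le_finrank`), for every `n`, against
moderate growth. Hence `z` is invertible. An invertible zigzag can be corrected to the identity, and
the image of the other zigzag, an idempotent, is then a dual of `X`
(`exists_exactPairing_of_zigzag_eq_id`). As `z` factors through `f`, and endomorphisms of `X` are
invertible or nilpotent, `f` is invertible as well, so that all non-invertible endomorphisms are
null.

It follows that every non-null morphism between indecomposable objects is invertible
(`isIso_of_not_isNull`) and that null morphisms are the same as negligible ones
(`isNegligibleMorphism_iff_isNull`). With the Krull–Schmidt decomposition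
(`induction_indecomposable`), every object of the quotient is a direct sum of images of
non-negligible objects, between which nonzero morphisms are invertible. Such a category is abelian
and semisimple (`IsSemisimpleClass.abelian`).

Finally, the classes of the non-negligible objects span `K(C)`, and their images in the Grothendieck
ring of the quotient are separated by the functions `dim Hom(F(X), -)`
(`eq_zero_of_kRingMap_linearCombination`). This gives their linear independence, and at the same
time the injectivity of the map from `K(C)` to the Grothendieck ring.
-/

namespace Semisimplification

/-! ### Indecomposable objects of a Hom-finite idempotent complete category -/

section KrullSchmidt

/-- In a commutative Artinian ring every element `a` is, up to a nilpotent, a unit on the image of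
an idempotent `e = a * b`. -/
lemma exists_idempotent_mul {B : Type v} [CommRing B] [IsArtinianRing B] (a : B) :
    ∃ (b : B) (n : ℕ), (a * b) * (a * b) = a * b ∧ a ^ n * (a * b) = a ^ n := by
  obtain ⟨n, y, hy⟩ := IsArtinian.exists_pow_succ_smul_dvd a (1 : B)
  simp only [smul_eq_mul, mul_one, Nat.succ_eq_add_one] at hy
  have h1 : ∀ m, a ^ n * (a * y) ^ m = a ^ n := by
    intro m
    induction m with
    | zero => simp
    | succ m ih =>
      calc a ^ n * (a * y) ^ (m + 1) = (a ^ (n + 1) * y) * (a * y) ^ m := by ring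
        _ = a ^ n := by rw [hy, ih]
  have h2 : a * (y * (a * y) ^ n) = (a * y) ^ (n + 1) := by ring
  refine ⟨y * (a * y) ^ n, n, ?_, by rw [h2, h1]⟩
  rw [h2]
  calc (a * y) ^ (n + 1) * (a * y) ^ (n + 1)
      = a * y ^ (n + 1) * (a ^ n * (a * y) ^ (n + 1)) := by ring
    _ = (a * y) ^ (n + 1) := by rw [h1]; ring

lemma isUnit_or_isNilpotent_of_idempotents {k : Type w} [Field k] {A : Type v} [Ring A]
    [Algebra k A] [Module.Finite k A] (idem : ∀ e : A, e * e = e → e = 0 ∨ e = 1) (a : A) :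
    IsUnit a ∨ IsNilpotent a := by
  let B := Algebra.adjoin k {a}
  have hcomm : IsMulCommutative B := Algebra.isMulCommutative_adjoin k (by
    rintro x rfl y rfl; rfl)
  have hB : IsArtinianRing B :=
    @isArtinian_of_tower k B B _ _ _ _ _ _ _ inferInstance
  let a' : B := ⟨a, Algebra.self_mem_adjoin_singleton k a⟩
  obtain ⟨b, n, h1, h2⟩ := exists_idempotent_mul a'
  rcases idem (a' * b : B) (congrArg Subtype.val h1) with h | h
  · right
    refine ⟨n, ?_⟩
    have h3 : a' ^ n = 0 := by
      rw [← h2, show a' * b = 0 from Subtype.ext h, mul_zero]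
    exact congrArg Subtype.val h3
  · left
    have h3 : a' * b = 1 := Subtype.ext h
    have h4 : b * a' = 1 := by rw [mul_comm, h3]
    exact ⟨⟨a, b, congrArg Subtype.val h3, congrArg Subtype.val h4⟩, rfl⟩

variable {C : Type u} [Category.{v} C] [Preadditive C] [HasBinaryBiproducts C]

lemma indecomposable_eq_zero_or_id_of_idem [IsIdempotentComplete C] {X : C}
    (hX : Indecomposable X) (e : X ⟶ X) (he : e ≫ e = e) : e = 0 ∨ e = 𝟙 X := by
  obtain ⟨Y, i, r, hir, hri⟩ := IsIdempotentComplete.idempotents_split X e he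
  obtain ⟨Z, j, s, hjs, hsj⟩ := IsIdempotentComplete.idempotents_split X (𝟙 X - e) (by simp [he])
  have his : i ≫ s = 0 := by
    have : i ≫ (s ≫ j) ≫ s = 0 := by
      rw [hsj, ← hri]; simp [reassoc_of% hir]
    simpa [hjs] using this
  have hjr : j ≫ r = 0 := by
    have : j ≫ (r ≫ i) ≫ r = 0 := by
      have : r ≫ i = 𝟙 X - s ≫ j := by rw [hri, hsj]; abel
      rw [this]; simp [reassoc_of% hjs]
    simpa [hir] using this
  let φ : X ≅ Y ⊞ Z :=
    { hom := biprod.lift r s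
      inv := biprod.desc i j
      hom_inv_id := by simp [biprod.lift_desc, hri, hsj]
      inv_hom_id := by ext <;> simp [hir, his, hjr, hjs] }
  rcases hX.2 Y Z φ with h | h
  · left; rw [← hri, h.eq_of_tgt r 0, zero_comp]
  · right
    have : 𝟙 X - e = 0 := by rw [← hsj, h.eq_of_tgt s 0, zero_comp]
    exact (sub_eq_zero.mp this).symm

variable (k : Type w) [Field k] [Linear k C]

lemma indecomposable_isIso_or_isNilpotent [IsIdempotentComplete C] {X : C}
    (hX : Indecomposable X) [hf : Module.Finite k (X ⟶ X)] (f : X ⟶ X) :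
    IsIso f ∨ IsNilpotent (R := End X) f := by
  have : Module.Finite k (End X) := hf
  rcases isUnit_or_isNilpotent_of_idempotents (k := k) (A := End X)
    (fun e he => indecomposable_eq_zero_or_id_of_idem hX e he) f with h | h
  · exact Or.inl ((isUnit_iff_isIso f).mp h)
  · exact Or.inr h

/-- The Krull–Schmidt decomposition, as an induction principle. -/
theorem induction_indecomposable (finite_hom : ∀ X Y : C, Module.Finite k (X ⟶ Y))
    {P : C → Prop} (zero : ∀ X, IsZero X → P X) (indecomposable : ∀ X, Indecomposable X → P X)
    (iso : ∀ X Y, (X ≅ Y) → P X → P Y) (sum : ∀ X Y, P X → P Y → P (X ⊞ Y)) (X : C) : P X := by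
  induction hn : Module.finrank k (X ⟶ X) using Nat.strong_induction_on generalizing X with
  | _ n ih =>
    subst hn
    by_cases hz : IsZero X
    · exact zero X hz
    by_cases hi : Indecomposable X
    · exact indecomposable X hi
    obtain ⟨Y, Z, e, hY, hZ⟩ : ∃ Y Z, ∃ _ : X ≅ Y ⊞ Z, ¬ IsZero Y ∧ ¬ IsZero Z := by
      by_contra! h
      exact hi ⟨hz, fun Y Z e => or_iff_not_imp_left.mpr (h Y Z e)⟩
    let L : ((Y ⟶ Y) × (Z ⟶ Z)) →ₗ[k] (X ⟶ X) :=
      { toFun := fun p => e.hom ≫ biprod.map p.1 p.2 ≫ e.inv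
        map_add' := fun p q => by
          rw [← Preadditive.comp_add, ← Preadditive.add_comp]
          congr 2
          ext <;> simp
        map_smul' := fun c p => by
          rw [RingHom.id_apply, ← Linear.comp_smul, ← Linear.smul_comp]
          congr 2
          ext <;> simp }
    have hL : Function.Injective L := by
      rintro ⟨p₁, p₂⟩ ⟨q₁, q₂⟩ h
      have h : biprod.map p₁ p₂ = biprod.map q₁ q₂ := by
        simpa [L] using h
      have h1 := congrArg (fun t => biprod.inl ≫ t ≫ biprod.fst) h
      have h2 := congrArg (fun t => biprod.inr ≫ t ≫ biprod.snd) h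
      simp at h1 h2
      rw [h1, h2]
    have := finite_hom
    have hle := LinearMap.finrank_le_finrank_of_injective hL
    rw [Module.finrank_prod] at hle
    have pos : ∀ T : C, ¬ IsZero T → 0 < Module.finrank k (T ⟶ T) := fun T hT => by
      have : Nontrivial (T ⟶ T) := ⟨𝟙 T, 0, fun h => hT ((IsZero.iff_id_eq_zero T).mpr h)⟩
      exact Module.finrank_pos
    have h1 := pos Y hY
    have h2 := pos Z hZ
    exact iso _ _ e.symm (sum Y Z (ih _ (by omega) Y rfl) (ih _ (by omega) Z rfl))

end KrullSchmidt

/-! ### The ideal of null morphisms -/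

section Null

variable {C : Type u} [Category.{v} C] [MonoidalCategory C] [Preadditive C]

/-- A morphism `f : A ⟶ B` is null if it vanishes in every composite `𝟙 ⟶ A ⊗ Y ⟶ B ⊗ Y ⟶ 𝟙`.
This makes sense without duals; under moderate growth it agrees with negligibility. -/
def IsNull {A B : C} (f : A ⟶ B) : Prop :=
  ∀ (Y : C) (i : 𝟙_ C ⟶ A ⊗ Y) (p : B ⊗ Y ⟶ 𝟙_ C), i ≫ f ▷ Y ≫ p = 0

namespace IsNull

lemma comp_left {A B D : C} (a : A ⟶ B) {f : B ⟶ D} (hf : IsNull f) : IsNull (a ≫ f) := by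
  intro Y i p
  simpa using hf Y (i ≫ a ▷ Y) p

lemma comp_right {A B D : C} {f : A ⟶ B} (hf : IsNull f) (b : B ⟶ D) : IsNull (f ≫ b) := by
  intro Y i p
  simpa using hf Y i (b ▷ Y ≫ p)

lemma whiskerRight {A B : C} {f : A ⟶ B} (hf : IsNull f) (Z : C) : IsNull (f ▷ Z) := by
  intro Y i p
  simpa using hf (Z ⊗ Y) (i ≫ (α_ A Z Y).hom) ((α_ B Z Y).inv ≫ p)

lemma whiskerLeft [BraidedCategory C] {A B : C} {f : A ⟶ B} (hf : IsNull f) (Z : C) :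
    IsNull (Z ◁ f) := by
  have h := ((hf.whiskerRight Z).comp_left (β_ Z A).hom).comp_right (β_ Z B).inv
  rwa [← BraidedCategory.braiding_naturality_right, Category.assoc, Iso.hom_inv_id,
    Category.comp_id] at h

lemma eq_zero {f : 𝟙_ C ⟶ 𝟙_ C} (hf : IsNull f) : f = 0 := by
  have h := hf (𝟙_ C) (ρ_ (𝟙_ C)).inv (ρ_ (𝟙_ C)).hom
  simpa using h

lemma neg {A B : C} {f : A ⟶ B} (hf : IsNull f) : IsNull (-f) := by
  have h := hf.comp_right (-𝟙 B)
  simpa using h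

variable [MonoidalPreadditive C]

lemma zero (A B : C) : IsNull (0 : A ⟶ B) := by
  intro Y i p; simp

lemma add {A B : C} {f g : A ⟶ B} (hf : IsNull f) (hg : IsNull g) : IsNull (f + g) := by
  intro Y i p
  simp [MonoidalPreadditive.add_whiskerRight, hf Y i p, hg Y i p]

lemma smul {k : Type w} [Field k] [Linear k C] [MonoidalLinear k C] (c : k) {A B : C}
    {f : A ⟶ B} (hf : IsNull f) : IsNull (c • f) := by
  intro Y i p
  simp [MonoidalLinear.smul_whiskerRight, hf Y i p]

lemma sum {ι : Type*} (s : Finset ι) {A B : C} {f : ι → (A ⟶ B)} (hf : ∀ j ∈ s, IsNull (f j)) :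
    IsNull (∑ j ∈ s, f j) := by
  classical
  induction s using Finset.induction_on with
  | empty => simpa using zero A B
  | insert a s ha ih =>
    rw [Finset.sum_insert ha]
    exact (hf _ (by simp)).add (ih fun j hj => hf j (by simp [hj]))

end IsNull

end Null

/-! ### Partial traces -/

section PartialTrace

variable {C : Type u} [Category.{v} C] [MonoidalCategory C]

/-- The partial closure `Z ⟶ (Z ⊗ X) ⊗ Y ⟶ (Z' ⊗ X) ⊗ Y ⟶ Z'` of `h : Z ⊗ X ⟶ Z' ⊗ X` along
arbitrary morphisms `i : 𝟙 ⟶ X ⊗ Y` and `p : X ⊗ Y ⟶ 𝟙`; no duality is assumed. -/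
def partialTrace {X Y : C} (i : 𝟙_ C ⟶ X ⊗ Y) (p : X ⊗ Y ⟶ 𝟙_ C) {Z Z' : C}
    (h : Z ⊗ X ⟶ Z' ⊗ X) : Z ⟶ Z' :=
  ((ρ_ Z).inv ≫ Z ◁ i ≫ (α_ Z X Y).inv) ≫ h ▷ Y ≫ (α_ Z' X Y).hom ≫ Z' ◁ p ≫ (ρ_ Z').hom

/-- The exchange `(Z ⊗ V) ⊗ X ≅ (Z ⊗ X) ⊗ V` of the last two factors. -/
def exchange [BraidedCategory C] (Z V X : C) : (Z ⊗ V) ⊗ X ≅ (Z ⊗ X) ⊗ V :=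
  α_ Z V X ≪≫ whiskerLeftIso Z (β_ V X) ≪≫ (α_ Z X V).symm

lemma exchange_naturality_left [BraidedCategory C] {Z Z' : C} (q : Z ⟶ Z') (V X : C) :
    (q ▷ V) ▷ X ≫ (exchange Z' V X).hom = (exchange Z V X).hom ≫ (q ▷ X) ▷ V := by
  simp only [exchange, Iso.trans_hom, whiskerLeftIso_hom, Iso.symm_hom, Category.assoc]
  rw [associator_naturality_left_assoc, ← whisker_exchange_assoc, associator_inv_naturality_left]

section

variable {X Y : C} (i : 𝟙_ C ⟶ X ⊗ Y) (p : X ⊗ Y ⟶ 𝟙_ C)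

lemma partialTrace_comp_left {Z Z' Z'' : C} (a : Z ⟶ Z') (h : Z' ⊗ X ⟶ Z'' ⊗ X) :
    partialTrace i p (a ▷ X ≫ h) = a ≫ partialTrace i p h := by
  have : a ≫ (ρ_ Z').inv ≫ Z' ◁ i ≫ (α_ Z' X Y).inv
      = ((ρ_ Z).inv ≫ Z ◁ i ≫ (α_ Z X Y).inv) ≫ (a ▷ X) ▷ Y := by
    rw [rightUnitor_inv_naturality_assoc, ← whisker_exchange_assoc, Category.assoc, Category.assoc,
      associator_inv_naturality_left]
  simp only [partialTrace, comp_whiskerRight, Category.assoc] at *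
  rw [reassoc_of% this]

lemma partialTrace_comp_right {Z Z' Z'' : C} (h : Z ⊗ X ⟶ Z' ⊗ X) (b : Z' ⟶ Z'') :
    partialTrace i p (h ≫ b ▷ X) = partialTrace i p h ≫ b := by
  have : (b ▷ X) ▷ Y ≫ (α_ Z'' X Y).hom ≫ Z'' ◁ p ≫ (ρ_ Z'').hom
      = (α_ Z' X Y).hom ≫ Z' ◁ p ≫ (ρ_ Z').hom ≫ b := by
    rw [associator_naturality_left_assoc, ← whisker_exchange_assoc, rightUnitor_naturality]
  simp only [partialTrace, comp_whiskerRight, Category.assoc]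
  rw [this]

lemma partialTrace_whiskerLeft {Z : C} (f : X ⟶ X) :
    partialTrace i p (Z ◁ f) = (ρ_ Z).inv ≫ Z ◁ (i ≫ f ▷ Y ≫ p) ≫ (ρ_ Z).hom := by
  simp [partialTrace]

lemma partialTrace_sum [Preadditive C] [MonoidalPreadditive C] {ι : Type*} (s : Finset ι)
    {Z Z' : C} (h : ι → (Z ⊗ X ⟶ Z' ⊗ X)) :
    partialTrace i p (∑ j ∈ s, h j) = ∑ j ∈ s, partialTrace i p (h j) := by
  simp [partialTrace, sum_whiskerRight, Preadditive.sum_comp, Preadditive.comp_sum]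

lemma IsNull.partialTrace [Preadditive C] {Z Z' : C} {h : Z ⊗ X ⟶ Z' ⊗ X} (hh : IsNull h) :
    IsNull (partialTrace i p h) :=
  ((hh.whiskerRight Y).comp_right _).comp_left _

variable [BraidedCategory C]

/-- The morphism `i` can be moved past a strand `V` on its left. -/
lemma coev_exchange (Z V : C) :
    ((ρ_ (Z ⊗ V)).inv ≫ (Z ⊗ V) ◁ i ≫ (α_ (Z ⊗ V) X Y).inv) ≫ (exchange Z V X).hom ▷ Y ≫
      (exchange (Z ⊗ X) V Y).hom = ((ρ_ Z).inv ≫ Z ◁ i ≫ (α_ Z X Y).inv) ▷ V := by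
  have key : (ρ_ V).inv ≫ V ◁ i ≫ (α_ V X Y).inv ≫ (β_ V X).hom ▷ Y ≫ (α_ X V Y).hom ≫
      X ◁ (β_ V Y).hom ≫ (α_ X Y V).inv = (λ_ V).inv ≫ i ▷ V := by
    have h := BraidedCategory.braiding_naturality_right V i
    rw [BraidedCategory.braiding_tensor_right_hom] at h
    rw [h]
    simp
  calc _ = 𝟙 _ ⊗≫ Z ◁ ((ρ_ V).inv ≫ V ◁ i ≫ (α_ V X Y).inv ≫ (β_ V X).hom ▷ Y ≫ (α_ X V Y).hom ≫
      X ◁ (β_ V Y).hom ≫ (α_ X Y V).inv) ⊗≫ 𝟙 _ := by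
        simp only [exchange, Iso.trans_hom, whiskerLeftIso_hom, Iso.symm_hom]
        monoidal
    _ = _ := by
        rw [key]
        monoidal

/-- The morphism `p` can be moved past a strand `V` on its left. -/
lemma exchange_ev (Z V : C) :
    (exchange Z V X).hom ▷ Y ≫ (exchange (Z ⊗ X) V Y).hom ≫
      ((α_ Z X Y).hom ≫ Z ◁ p ≫ (ρ_ Z).hom) ▷ V =
    (α_ (Z ⊗ V) X Y).hom ≫ (Z ⊗ V) ◁ p ≫ (ρ_ (Z ⊗ V)).hom := by
  have key : (α_ V X Y).inv ≫ (β_ V X).hom ▷ Y ≫ (α_ X V Y).hom ≫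
      X ◁ (β_ V Y).hom ≫ (α_ X Y V).inv ≫ p ▷ V ≫ (λ_ V).hom = V ◁ p ≫ (ρ_ V).hom := by
    have h := BraidedCategory.braiding_naturality_right V p
    rw [BraidedCategory.braiding_tensor_right_hom, braiding_tensorUnit_right] at h
    rw [← cancel_mono (λ_ V).inv]
    simpa using h.symm
  calc _ = 𝟙 _ ⊗≫ Z ◁ ((α_ V X Y).inv ≫ (β_ V X).hom ▷ Y ≫ (α_ X V Y).hom ≫
      X ◁ (β_ V Y).hom ≫ (α_ X Y V).inv ≫ p ▷ V ≫ (λ_ V).hom) ⊗≫ 𝟙 _ := by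
        simp only [exchange, Iso.trans_hom, whiskerLeftIso_hom, Iso.symm_hom]
        monoidal
    _ = _ := by
        rw [key]
        monoidal

/-- A closed strand that passes behind `V` on both sides can be pulled off `V`. -/
lemma partialTrace_conj_exchange {Z Z' : C} (V : C) (q : Z ⊗ X ⟶ Z' ⊗ X) :
    partialTrace i p ((exchange Z V X).hom ≫ q ▷ V ≫ (exchange Z' V X).inv) =
      partialTrace i p q ▷ V := by
  have h1 : ((ρ_ (Z ⊗ V)).inv ≫ (Z ⊗ V) ◁ i ≫ (α_ (Z ⊗ V) X Y).inv) ≫ (exchange Z V X).hom ▷ Y =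
      ((ρ_ Z).inv ≫ Z ◁ i ≫ (α_ Z X Y).inv) ▷ V ≫ (exchange (Z ⊗ X) V Y).inv := by
    rw [Iso.eq_comp_inv, Category.assoc, coev_exchange]
  have h2 : (exchange Z' V X).inv ▷ Y ≫ (α_ (Z' ⊗ V) X Y).hom ≫ (Z' ⊗ V) ◁ p ≫
      (ρ_ (Z' ⊗ V)).hom = (exchange (Z' ⊗ X) V Y).hom ≫
        ((α_ Z' X Y).hom ≫ Z' ◁ p ≫ (ρ_ Z').hom) ▷ V := by
    rw [← exchange_ev, inv_hom_whiskerRight_assoc]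
  have h3 := exchange_naturality_left q V Y
  simp only [partialTrace, comp_whiskerRight, Category.assoc] at h1 h2 ⊢
  rw [h2, reassoc_of% h1, reassoc_of% h3, Iso.inv_hom_id_assoc]

/-- The zigzag `X ⟶ X ⊗ (Y ⊗ X) ≅ (X ⊗ Y) ⊗ X ⟶ X`. -/
def zigzag (c : 𝟙_ C ⟶ Y ⊗ X) (p : X ⊗ Y ⟶ 𝟙_ C) : X ⟶ X :=
  (ρ_ X).inv ≫ X ◁ c ≫ (α_ X Y X).inv ≫ p ▷ X ≫ (λ_ X).hom

/-- The closure of a single crossing is a zigzag. -/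
lemma partialTrace_exchange_inv (Z : C) :
    partialTrace i p (exchange Z X X).inv = Z ◁ zigzag (i ≫ (β_ X Y).hom) p := by
  have h2 := exchange_ev p Z X
  rw [partialTrace, ← h2]
  simp [← comp_whiskerRight_assoc, -comp_whiskerRight]
  simp only [exchange, Iso.trans_hom, whiskerLeftIso_hom, Iso.symm_hom, zigzag]
  monoidal

end

end PartialTrace

/-! ### Permutation braids are linearly independent -/

section PermutationBraids

variable {C : Type u} [Category.{v} C] [MonoidalCategory C] [BraidedCategory C]

lemma exchange_naturality {Z Z' V V' X X' : C} (a : Z ⟶ Z') (b : V ⟶ V') (c : X ⟶ X') :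
    ((a ⊗ₘ b) ⊗ₘ c) ≫ (exchange Z' V' X').hom = (exchange Z V X).hom ≫ ((a ⊗ₘ c) ⊗ₘ b) := by
  simp only [exchange, Iso.trans_hom, whiskerLeftIso_hom, Iso.symm_hom, Category.assoc]
  rw [associator_naturality_assoc, ← associator_inv_naturality, ← id_tensorHom, ← id_tensorHom,
    tensorHom_comp_tensorHom_assoc, tensorHom_comp_tensorHom_assoc,
    BraidedCategory.braiding_naturality, Category.comp_id, Category.id_comp]

lemma exchange_inv_naturality {Z Z' V V' X X' : C} (a : Z ⟶ Z') (b : V ⟶ V') (c : X ⟶ X') :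
    ((a ⊗ₘ c) ⊗ₘ b) ≫ (exchange Z' V' X').inv = (exchange Z V X).inv ≫ ((a ⊗ₘ b) ⊗ₘ c) := by
  rw [Iso.comp_inv_eq, Category.assoc, exchange_naturality, Iso.inv_hom_id_assoc]

variable [Preadditive C]

/-- A family of braids `d j` on `n + 1` strands, of which the first `n` form the object `Z` and the
last is `X`. The braid `d j` moves the strand in position `j` to the last position; for `j < m` the
partial closure of `(d m)⁻¹ ≫ d j` then contains a zigzag, which makes it null after composition
with `a`, the `n`-th tensor power of an endomorphism of `X`. -/
structure StrandMovers {X Y : C} (f : X ⟶ X) (i : 𝟙_ C ⟶ X ⊗ Y) (p : X ⊗ Y ⟶ 𝟙_ C)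
    {Z : C} (a : Z ⟶ Z) (n : ℕ) where
  /-- the braid that moves strand `j` to the end -/
  d : Fin (n + 1) → (Z ⊗ X ≅ Z ⊗ X)
  comm (j : Fin (n + 1)) : (a ⊗ₘ f) ≫ (d j).hom = (d j).hom ≫ (a ⊗ₘ f)
  null (m j : Fin (n + 1)) : j < m → IsNull (a ≫ partialTrace i p ((d m).inv ≫ (d j).hom))

section

variable {X Y : C} (f : X ⟶ X) (i : 𝟙_ C ⟶ X ⊗ Y) (p : X ⊗ Y ⟶ 𝟙_ C)

/-- On a single strand the identity is the only mover. -/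
def StrandMovers.unit {Z : C} (a : Z ⟶ Z) : StrandMovers f i p a 0 where
  d _ := Iso.refl _
  comm _ := by simp
  null m j hj := by omega

variable {f i p}

/-- The movers on `n + 2` strands: the identity, and the movers on the first `n + 1` strands
followed by a crossing of the last two strands. -/
def StrandMovers.succ (h : IsNull (f ≫ zigzag (i ≫ (β_ X Y).hom) p)) {Z : C} {a : Z ⟶ Z} {n : ℕ}
    (s : StrandMovers f i p a n) : StrandMovers f i p (a ⊗ₘ f) (n + 1) where
  d := Fin.lastCases (Iso.refl _)
    (fun j => whiskerRightIso (s.d j) X ≪≫ (exchange Z X X).symm)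
  comm j := by
    induction j using Fin.lastCases with
    | last => simp
    | cast j =>
      simp only [Fin.lastCases_castSucc, Iso.trans_hom, whiskerRightIso_hom, Iso.symm_hom,
        Category.assoc]
      rw [← exchange_inv_naturality, ← tensorHom_id, tensorHom_comp_tensorHom_assoc,
        tensorHom_comp_tensorHom_assoc, s.comm, Category.id_comp, Category.comp_id]
  null m j hj := by
    obtain ⟨j, rfl⟩ : ∃ j', j = Fin.castSucc j' := ⟨j.castPred (Fin.ne_last_of_lt hj), by simp⟩
    induction m using Fin.lastCases with
    | last =>
      simp only [Fin.lastCases_castSucc, Fin.lastCases_last, Iso.trans_hom, whiskerRightIso_hom,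
        Iso.symm_hom, Iso.refl_inv, Category.id_comp]
      rw [partialTrace_comp_left, partialTrace_exchange_inv, ← Category.assoc, s.comm,
        Category.assoc, MonoidalCategory.tensorHom_def, Category.assoc, ← whiskerLeft_comp]
      exact ((h.whiskerLeft _).comp_left _).comp_left _
    | cast m =>
      have hjm : j < m := by simpa using hj
      simp only [Fin.lastCases_castSucc, Iso.trans_hom, whiskerRightIso_hom, whiskerRightIso_inv,
        Iso.symm_hom, Iso.symm_inv, Iso.trans_inv, Category.assoc]
      rw [← comp_whiskerRight_assoc, partialTrace_conj_exchange, tensorHom_def', Category.assoc,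
        ← comp_whiskerRight]
      exact ((s.null m j hjm).whiskerRight X).comp_left _

end

variable [MonoidalPreadditive C] {k : Type w} [Field k] [Linear k C]

omit [BraidedCategory C] [Preadditive C] [MonoidalPreadditive C] in
lemma partialTrace_tensorHom_comp {X Y : C} (f : X ⟶ X) (i : 𝟙_ C ⟶ X ⊗ Y)
    (p : X ⊗ Y ⟶ 𝟙_ C) {Z Z' : C} (a : Z ⟶ Z) (h : Z ⊗ X ⟶ Z' ⊗ X) :
    partialTrace i p ((a ⊗ₘ f) ≫ h) = a ≫ partialTrace (i ≫ f ▷ Y) p h := by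
  rw [MonoidalCategory.tensorHom_def, Category.assoc, partialTrace_comp_left]
  simp [partialTrace]

/-- `Z` has `N` endomorphisms that are linearly independent modulo null morphisms, even after
composition with `a`. -/
def HasIndependentFamily (k : Type w) [Field k] [Linear k C] {Z : C} (a : Z ⟶ Z) (N : ℕ) : Prop :=
  ∃ (ι : Type) (_ : Fintype ι) (g : ι → (Z ⟶ Z)), Fintype.card ι = N ∧
    ∀ c : ι → k, IsNull (a ≫ ∑ x, c x • g x) → c = 0

omit [BraidedCategory C] [MonoidalPreadditive C] in
lemma HasIndependentFamily.le_finrank {Z : C} {a : Z ⟶ Z} {N : ℕ}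
    (h : HasIndependentFamily k a N) [Module.Finite k (Z ⟶ Z)] (h0 : IsNull (0 : Z ⟶ Z)) :
    N ≤ Module.finrank k (Z ⟶ Z) := by
  obtain ⟨ι, _, g, rfl, hg⟩ := h
  have : LinearIndependent k g := by
    rw [Fintype.linearIndependent_iff]
    intro c hc x
    have := hg c (by rw [hc, comp_zero]; exact h0)
    exact congrFun this x
  exact this.fintype_card_le_finrank

omit [BraidedCategory C] in
/-- Multiplying the braids on the first strands by the braids that move one strand to the end. The
coefficients are recovered one position at a time, from the last position downwards: closing the
last strand kills the terms from earlier positions. -/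
lemma HasIndependentFamily.succ [MonoidalLinear k C] {X Y : C} {f : X ⟶ X} {i : 𝟙_ C ⟶ X ⊗ Y}
    {p : X ⊗ Y ⟶ 𝟙_ C} (hf : i ≫ f ▷ Y ≫ p = 𝟙 (𝟙_ C)) {Z : C} {a : Z ⟶ Z} {n N : ℕ}
    (s : StrandMovers f (i ≫ f ▷ Y) p a n) (h : HasIndependentFamily k a N) :
    HasIndependentFamily k (a ⊗ₘ f) ((n + 1) * N) := by
  obtain ⟨ι, _, g, hι, hg⟩ := h
  refine ⟨Fin (n + 1) × ι, inferInstance, fun x => (s.d x.1).hom ≫ g x.2 ▷ X, by simp [hι],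
    fun c hc => ?_⟩
  suffices H : ∀ m : Fin (n + 1), (fun x => c (m, x)) = 0 by
    funext ⟨m, x⟩
    exact congrFun (H m) x
  intro m
  induction m using WellFoundedGT.induction with
  | _ m hm =>
    apply hg
    -- close the last strand of the given relation, after undoing the braid `d m`
    have h1 := (hc.comp_left (s.d m).inv).partialTrace i p
    have h2 : (s.d m).inv ≫ (a ⊗ₘ f) = (a ⊗ₘ f) ≫ (s.d m).inv := by
      rw [Iso.inv_comp_eq, ← Category.assoc, ← s.comm, Category.assoc, Iso.hom_inv_id,
        Category.comp_id]
    have h3 : (s.d m).inv ≫ ∑ x : Fin (n + 1) × ι, c x • (s.d x.1).hom ≫ g x.2 ▷ X =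
        ∑ j, ((s.d m).inv ≫ (s.d j).hom) ≫ (∑ x, c (j, x) • g x) ▷ X := by
      rw [Fintype.sum_prod_type, Preadditive.comp_sum]
      refine Finset.sum_congr rfl fun j _ => ?_
      simp [Preadditive.comp_sum, sum_whiskerRight, MonoidalLinear.smul_whiskerRight]
    rw [reassoc_of% h2, h3, partialTrace_tensorHom_comp, partialTrace_sum,
      ← Finset.add_sum_erase _ _ (Finset.mem_univ m), Preadditive.comp_add] at h1
    have h4 : IsNull (a ≫ ∑ j ∈ Finset.univ.erase m, partialTrace (i ≫ f ▷ Y) p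
        (((s.d m).inv ≫ (s.d j).hom) ≫ (∑ x, c (j, x) • g x) ▷ X)) := by
      rw [Preadditive.comp_sum]
      refine IsNull.sum _ fun j hj => ?_
      rcases lt_or_gt_of_ne (Finset.ne_of_mem_erase hj) with hjm | hjm
      · rw [partialTrace_comp_right, ← Category.assoc]
        exact (s.null m j hjm).comp_right _
      · have : ∀ x, c (j, x) = 0 := fun x => congrFun (hm j hjm) x
        simpa [this, partialTrace] using IsNull.zero Z Z
    have h5 := h1.add h4.neg
    rw [add_neg_cancel_right, partialTrace_comp_right, Iso.inv_hom_id] at h5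
    have h6 : partialTrace (i ≫ f ▷ Y) p (𝟙 (Z ⊗ X)) = 𝟙 Z := by
      rw [← whiskerLeft_id, partialTrace_whiskerLeft]
      simp [hf]
    rwa [h6, Category.id_comp] at h5

/-- If the closure of `f` is `1` and `f` followed by the zigzag is null, then the `n!` permutation
braids on `n` strands are linearly independent. -/
theorem factorial_le_finrank [MonoidalLinear k C] (finite_hom : ∀ X Y : C, Module.Finite k (X ⟶ Y))
    (end_unit : Function.Injective fun c : k => c • 𝟙 (𝟙_ C))
    {X Y : C} (f : X ⟶ X) (i : 𝟙_ C ⟶ X ⊗ Y) (p : X ⊗ Y ⟶ 𝟙_ C)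
    (hf : i ≫ f ▷ Y ≫ p = 𝟙 (𝟙_ C))
    (h : IsNull (f ≫ zigzag ((i ≫ f ▷ Y) ≫ (β_ X Y).hom) p)) (n : ℕ) :
    n.factorial ≤ Module.finrank k (tensorPower X n ⟶ tensorPower X n) := by
  have H : ∀ n, ∃ a : tensorPower X n ⟶ tensorPower X n,
      Nonempty (StrandMovers f (i ≫ f ▷ Y) p a n) ∧ HasIndependentFamily k a n.factorial := by
    intro n
    induction n with
    | zero =>
      refine ⟨𝟙 (𝟙_ C), ⟨StrandMovers.unit _ _ _ _⟩, Unit, inferInstance, fun _ => 𝟙 (𝟙_ C),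
        by simp, fun c hc => ?_⟩
      have h0 : c default • 𝟙 (𝟙_ C) = 0 := by
        rw [Finset.univ_unique, Finset.sum_singleton] at hc
        have hc := IsNull.eq_zero (f := 𝟙 (𝟙_ C) ≫ (c default • 𝟙 (𝟙_ C))) hc
        rwa [Category.id_comp] at hc
      funext x
      exact end_unit (by simpa using h0)
    | succ n ih =>
      obtain ⟨a, ⟨s⟩, ha⟩ := ih
      exact ⟨a ⊗ₘ f, ⟨s.succ h⟩, ha.succ hf s⟩
  obtain ⟨a, _, ha⟩ := H n
  exact ha.le_finrank (IsNull.zero _ _)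

end PermutationBraids

/-! ### Duals from zigzags -/

section Zigzag

variable {C : Type u} [Category.{v} C] [MonoidalCategory C]

/-- The zigzag `Y ⟶ (Y ⊗ X) ⊗ Y ≅ Y ⊗ (X ⊗ Y) ⟶ Y`. -/
def cozigzag {X Y : C} (c : 𝟙_ C ⟶ Y ⊗ X) (p : X ⊗ Y ⟶ 𝟙_ C) : Y ⟶ Y :=
  (λ_ Y).inv ≫ c ▷ Y ≫ (α_ Y X Y).hom ≫ Y ◁ p ≫ (ρ_ Y).hom

lemma zigzag_comp_left {X Z Y : C} (c : 𝟙_ C ⟶ Y ⊗ Z) (p : Z ⊗ Y ⟶ 𝟙_ C) (a : X ⟶ Z) (b : Z ⟶ X) :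
    zigzag (c ≫ Y ◁ b) (a ▷ Y ≫ p) = a ≫ zigzag c p ≫ b := by
  simp only [zigzag]
  calc _ = 𝟙 _ ⊗≫ X ◁ c ⊗≫ ((X ⊗ Y) ◁ b ≫ (a ▷ Y ≫ p) ▷ X) ⊗≫ 𝟙 _ := by monoidal
    _ = 𝟙 _ ⊗≫ (X ◁ c ≫ a ▷ (Y ⊗ Z)) ⊗≫ p ▷ Z ⊗≫ b := by rw [whisker_exchange]; monoidal
    _ = _ := by rw [whisker_exchange]; monoidal

lemma zigzag_slide {X Y Y' : C} (c : 𝟙_ C ⟶ Y ⊗ X) (v : Y ⟶ Y') (p : X ⊗ Y' ⟶ 𝟙_ C) :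
    zigzag (c ≫ v ▷ X) p = zigzag c (X ◁ v ≫ p) := by
  simp [zigzag]

lemma comp_cozigzag {X Y : C} (c : 𝟙_ C ⟶ Y ⊗ X) (p : X ⊗ Y ⟶ 𝟙_ C) :
    c ≫ cozigzag c p ▷ X = c ≫ Y ◁ zigzag c p := by
  simp only [zigzag, cozigzag]
  calc _ = 𝟙 _ ⊗≫ (𝟙_ C ◁ c ≫ c ▷ (Y ⊗ X)) ⊗≫ Y ◁ p ▷ X ⊗≫ 𝟙 _ := by monoidal
    _ = _ := by rw [whisker_exchange]; monoidal

lemma cozigzag_comp {X Y : C} (c : 𝟙_ C ⟶ Y ⊗ X) (p : X ⊗ Y ⟶ 𝟙_ C) {Y' : C} (r : Y ⟶ Y')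
    (s : Y' ⟶ Y) : cozigzag (c ≫ r ▷ X) (X ◁ s ≫ p) = s ≫ cozigzag c p ≫ r := by
  simp only [cozigzag]
  calc _ = 𝟙 _ ⊗≫ c ▷ Y' ⊗≫ (r ▷ (X ⊗ Y') ≫ Y' ◁ (X ◁ s ≫ p)) ⊗≫ 𝟙 _ := by monoidal
    _ = 𝟙 _ ⊗≫ (c ▷ Y' ≫ (Y ⊗ X) ◁ s) ⊗≫ Y ◁ p ⊗≫ r := by rw [← whisker_exchange]; monoidal
    _ = _ := by rw [← whisker_exchange]; monoidal

lemma cozigzag_idem {X Y : C} (c : 𝟙_ C ⟶ Y ⊗ X) (p : X ⊗ Y ⟶ 𝟙_ C) (h : zigzag c p = 𝟙 X) :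
    cozigzag c p ≫ cozigzag c p = cozigzag c p := by
  have h1 := cozigzag_comp c p (cozigzag c p) (𝟙 Y)
  rw [comp_cozigzag, h] at h1
  simpa using h1.symm

/-- If the zigzag of `X` is the identity, the other zigzag is an idempotent of `Y`, and its image is
a dual of `X`. -/
theorem exists_exactPairing_of_zigzag_eq_id [BraidedCategory C] [IsIdempotentComplete C] {X Y : C}
    (c : 𝟙_ C ⟶ Y ⊗ X) (p : X ⊗ Y ⟶ 𝟙_ C) (h : zigzag c p = 𝟙 X) :
    ∃ X' : C, Nonempty (ExactPairing X X') := by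
  obtain ⟨Y', s, r, hsr, hrs⟩ :=
    IsIdempotentComplete.idempotents_split Y (cozigzag c p) (cozigzag_idem c p h)
  have h1 : zigzag (c ≫ r ▷ X) (X ◁ s ≫ p) = 𝟙 X := by
    have : c ≫ (r ≫ s) ▷ X = c := by rw [hrs, comp_cozigzag, h]; simp
    rw [← zigzag_slide, Category.assoc, ← comp_whiskerRight, this, h]
  have h2 : cozigzag (c ≫ r ▷ X) (X ◁ s ≫ p) = 𝟙 Y' := by
    rw [cozigzag_comp, ← hrs]; simp [hsr]
  let P : ExactPairing Y' X :=
    { coevaluation' := c ≫ r ▷ X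
      evaluation' := X ◁ s ≫ p
      coevaluation_evaluation' := by
        rw [← cancel_epi (ρ_ X).inv, ← cancel_mono (λ_ X).hom]
        simpa [zigzag] using h1
      evaluation_coevaluation' := by
        rw [← cancel_epi (λ_ Y').inv, ← cancel_mono (ρ_ Y').hom]
        simpa [cozigzag] using h2 }
  exact ⟨Y', ⟨BraidedCategory.exactPairing_swap Y' X⟩⟩

/-- An endomorphism that is the zigzag of some pair of morphisms. -/
def IsZigzag {X : C} (g : X ⟶ X) : Prop :=
  ∃ (Y : C) (c : 𝟙_ C ⟶ Y ⊗ X) (p : X ⊗ Y ⟶ 𝟙_ C), zigzag c p = g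

lemma IsZigzag.comp {X Z : C} {g : Z ⟶ Z} (hg : IsZigzag g) (a : X ⟶ Z) (b : Z ⟶ X) :
    IsZigzag (a ≫ g ≫ b) := by
  obtain ⟨Y, c, p, rfl⟩ := hg
  exact ⟨Y, _, _, zigzag_comp_left c p a b⟩

lemma IsZigzag.add [Preadditive C] [MonoidalPreadditive C] [HasBinaryBiproducts C] {X : C}
    {g g' : X ⟶ X} (hg : IsZigzag g) (hg' : IsZigzag g') : IsZigzag (g + g') := by
  obtain ⟨Y, c, p, rfl⟩ := hg
  obtain ⟨Y', c', p', rfl⟩ := hg'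
  refine ⟨Y ⊞ Y', c ≫ biprod.inl ▷ X + c' ≫ biprod.inr ▷ X,
    X ◁ biprod.fst ≫ p + X ◁ biprod.snd ≫ p', ?_⟩
  have hadd : ∀ {W : C} (c₁ c₂ : 𝟙_ C ⟶ W ⊗ X) (p : X ⊗ W ⟶ 𝟙_ C),
      zigzag (c₁ + c₂) p = zigzag c₁ p + zigzag c₂ p := by
    intros; simp [zigzag, MonoidalPreadditive.whiskerLeft_add]
  rw [hadd, zigzag_slide, zigzag_slide]
  simp only [Preadditive.comp_add, ← whiskerLeft_comp_assoc, biprod.inl_fst, biprod.inl_snd,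
    biprod.inr_fst, biprod.inr_snd, whiskerLeft_id, Category.id_comp,
    MonoidalPreadditive.whiskerLeft_zero, zero_comp, add_zero, zero_add]

lemma isZigzag_zero [Preadditive C] [MonoidalPreadditive C] (X : C) : IsZigzag (0 : X ⟶ X) :=
  ⟨𝟙_ C, 0, 0, by simp [zigzag]⟩

lemma isZigzag_id_of_exactPairing {X Y : C} [ExactPairing Y X] : IsZigzag (𝟙 X) :=
  ⟨Y, ExactPairing.coevaluation Y X, ExactPairing.evaluation Y X, by
    have := ExactPairing.coevaluation_evaluation Y X
    rw [zigzag, reassoc_of% this]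
    simp⟩

end Zigzag

/-! ### Non-negligible objects of moderate growth -/

section Local

variable {C : Type u} [Category.{v} C] [Preadditive C]

/-- In an endomorphism ring whose elements are invertible or nilpotent, the two factors of an
invertible composite are invertible. -/
lemma isIso_of_isIso_comp {X : C} (hX : ∀ g : X ⟶ X, IsIso g ∨ IsNilpotent (R := End X) g)
    {a b : X ⟶ X} (hab : IsIso (a ≫ b)) : IsIso a ∧ IsIso b := by
  have zero : (𝟙 X = 0) → IsIso a ∧ IsIso b := fun h0 => by
    have h0 : IsZero X := (IsZero.iff_id_eq_zero X).mpr h0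
    exact ⟨⟨0, h0.eq_of_src _ _, h0.eq_of_src _ _⟩, ⟨0, h0.eq_of_src _ _, h0.eq_of_src _ _⟩⟩
  rcases hX a with h | ⟨n, hn⟩
  · exact ⟨h, IsIso.of_isIso_comp_left a b⟩
  · apply zero
    have h1 : (show End X from b ≫ inv (a ≫ b)) * (show End X from a) = 1 := by
      change a ≫ b ≫ inv (a ≫ b) = 𝟙 X
      rw [← Category.assoc, IsIso.hom_inv_id]
    have h2 := pow_mul_pow_eq_one n h1
    rw [hn, mul_zero] at h2
    exact h2.symm

variable [MonoidalCategory C] [MonoidalPreadditive C] {k : Type w} [Field k] [Linear k C]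

/-- An object whose identity is not null has an endomorphism `f` that represents an element
of the socle of its endomorphism ring modulo null morphisms: a non-null `f` for which `f ≫ End X`
has minimal dimension. -/
lemma exists_socle {X : C} [Module.Finite k (X ⟶ X)] (h1 : ¬ IsNull (𝟙 X))
    (hX : ∀ g : X ⟶ X, IsIso g ∨ IsNilpotent (R := End X) g) :
    ∃ f : X ⟶ X, ¬ IsNull f ∧ ∀ g : X ⟶ X, ¬ IsIso g → IsNull (f ≫ g) := by
  let R (f : X ⟶ X) : Submodule k (X ⟶ X) := LinearMap.range (Linear.leftComp k X f)
  obtain ⟨f, hf, hmin⟩ := (measure fun f : X ⟶ X => Module.finrank k (R f)).wf.has_min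
    {f | ¬ IsNull f} ⟨𝟙 X, h1⟩
  refine ⟨f, hf, fun g hg => ?_⟩
  by_contra hfg
  have hle : R (f ≫ g) ≤ R f := by
    rintro _ ⟨x, rfl⟩
    exact ⟨g ≫ x, by simp⟩
  have heq : R (f ≫ g) = R f :=
    Submodule.eq_of_le_of_finrank_le hle (not_lt.mp (hmin _ hfg))
  have hmem : f ∈ R (f ≫ g) := by
    rw [heq]
    exact ⟨𝟙 X, by simp⟩
  obtain ⟨x, hx⟩ := hmem
  have hx : f ≫ (g ≫ x) = f := by simpa using hx
  rcases hX (g ≫ x) with h | ⟨n, hn⟩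
  · exact hg (isIso_of_isIso_comp hX h).1
  · have : ∀ m : ℕ, f ≫ ((show End X from g ≫ x) ^ m : End X) = f := by
      intro m
      induction m with
      | zero => exact Category.comp_id f
      | succ m ih =>
        rw [pow_succ]
        change f ≫ (g ≫ x) ≫ _ = f
        rw [← Category.assoc, hx, ih]
    have h0 := this n
    rw [hn] at h0
    apply hf
    rw [← h0]
    have := IsNull.zero X X
    rwa [← comp_zero (f := f)] at this

end Local

section Growth

variable {C : Type u} [Category.{v} C] [Preadditive C] [HasBinaryBiproducts C]
  [IsIdempotentComplete C] [MonoidalCategory C] [BraidedCategory C] [MonoidalPreadditive C]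
  {k : Type w} [Field k] [Linear k C] [MonoidalLinear k C]

/-- An indecomposable object of moderate growth whose identity is not null has a dual, and its
non-invertible endomorphisms are null. -/
theorem exists_exactPairing_and_isNull (finite_hom : ∀ X Y : C, Module.Finite k (X ⟶ Y))
    (end_unit : Function.Bijective fun c : k => c • 𝟙 (𝟙_ C)) {X : C} (hX : Indecomposable X)
    (h1 : ¬ IsNull (𝟙 X)) (growth : HasModerateGrowth k X) :
    (∃ X' : C, Nonempty (ExactPairing X X')) ∧ ∀ g : X ⟶ X, ¬ IsIso g → IsNull g := by
  have hloc := indecomposable_isIso_or_isNilpotent k hX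
  obtain ⟨f, hf, hfg⟩ := exists_socle (k := k) h1 hloc
  simp only [IsNull] at hf
  push Not at hf
  obtain ⟨Y, i, p, hip⟩ := hf
  obtain ⟨c, hc⟩ := end_unit.2 (i ≫ f ▷ Y ≫ p)
  have hc0 : c ≠ 0 := by
    rintro rfl
    exact hip (by simpa using hc.symm)
  have hip1 : i ≫ f ▷ Y ≫ (c⁻¹ • p) = 𝟙 _ := by
    simp only [Linear.comp_smul]
    rw [← hc, smul_smul, inv_mul_cancel₀ hc0, one_smul]
  have hz : zigzag ((i ≫ f ▷ Y) ≫ (β_ X Y).hom) (c⁻¹ • p) =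
      zigzag (i ≫ (β_ X Y).hom) (c⁻¹ • p) ≫ f := by
    have := zigzag_comp_left (i ≫ (β_ X Y).hom) (c⁻¹ • p) (𝟙 X) f
    simpa using this
  have hiso : IsIso (zigzag ((i ≫ f ▷ Y) ≫ (β_ X Y).hom) (c⁻¹ • p)) := by
    by_contra hn
    -- otherwise the permutation braids on `n` strands are independent, for every `n`
    obtain ⟨n, hlt⟩ := growth
    exact absurd (factorial_le_finrank finite_hom end_unit.1 f i (c⁻¹ • p) hip1 (hfg _ hn) n)
      (not_le.mpr hlt)
  constructor
  · have := zigzag_comp_left ((i ≫ f ▷ Y) ≫ (β_ X Y).hom) (c⁻¹ • p)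
      (inv (zigzag ((i ≫ f ▷ Y) ≫ (β_ X Y).hom) (c⁻¹ • p))) (𝟙 X)
    exact exists_exactPairing_of_zigzag_eq_id _ _ (this.trans (by simp))
  · intro g hg
    rw [hz] at hiso
    have := (isIso_of_isIso_comp hloc hiso).2
    have h := (hfg g hg).comp_left (inv f)
    rwa [IsIso.inv_hom_id_assoc] at h

omit [IsIdempotentComplete C] [MonoidalPreadditive C] [MonoidalLinear k C] in
/-- An indecomposable object is non-negligible if and only if its identity is not null, since
`End(𝟙) = k` allows a nonzero endomorphism of the unit to be normalized to the identity. -/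
lemma isNonNegligible_iff (end_unit : Function.Bijective fun c : k => c • 𝟙 (𝟙_ C)) {X : C} :
    IsNonNegligible X ↔ Indecomposable X ∧ ¬ IsNull (𝟙 X) := by
  refine and_congr_right fun _ => ⟨?_, fun h => ?_⟩
  · rintro ⟨Y, ⟨r⟩⟩ h
    have h := h Y (r.i ≫ (β_ Y X).hom) ((β_ Y X).inv ≫ r.r)
    have h0 : (1 : k) = 0 := end_unit.1 (by simpa using h)
    exact one_ne_zero h0
  · simp only [IsNull] at h
    push Not at h
    obtain ⟨Y, i, p, hip⟩ := h
    obtain ⟨c, hc⟩ := end_unit.2 (i ≫ 𝟙 X ▷ Y ≫ p)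
    have hc0 : c ≠ 0 := by
      rintro rfl
      exact hip (by simpa using hc.symm)
    refine ⟨Y, ⟨⟨i ≫ (β_ X Y).hom, c⁻¹ • ((β_ X Y).inv ≫ p), ?_⟩⟩⟩
    have hc : c • 𝟙 (𝟙_ C) = i ≫ p := by simpa using hc
    simp only [Linear.comp_smul, Category.assoc, Iso.hom_inv_id_assoc]
    rw [← hc, smul_smul, inv_mul_cancel₀ hc0, one_smul]

omit [HasBinaryBiproducts C] [IsIdempotentComplete C] [MonoidalPreadditive C] in
/-- If `A` has a dual `A'`, arbitrary morphisms `𝟙 ⟶ A ⊗ Y` and `B ⊗ Y ⟶ 𝟙` come from morphisms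
`A' ⟶ Y` and `B ⟶ A`, so that non-null morphisms from `A` are detected by traces. -/
lemma exists_quantumTrace_ne_zero {A A' B : C} [ExactPairing A A'] {f : A ⟶ B} (hf : ¬ IsNull f) :
    ∃ g : B ⟶ A, quantumTrace A A' (f ≫ g) ≠ 0 := by
  simp only [IsNull] at hf
  push Not at hf
  obtain ⟨Y, i, p, hip⟩ := hf
  let t : A' ⟶ Y := (ρ_ A').inv ≫ (tensorLeftHomEquiv (𝟙_ C) A A' Y).symm i
  have ht : ExactPairing.coevaluation A A' ≫ A ◁ t = i := by
    have h := (tensorLeftHomEquiv (𝟙_ C) A A' Y).apply_symm_apply i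
    rw [← h]
    simp only [tensorLeftHomEquiv, Equiv.coe_fn_mk, t]
    monoidal
  let q : B ⊗ A' ⟶ 𝟙_ C := B ◁ t ≫ p
  let := BraidedCategory.exactPairing_swap A A'
  let g : B ⟶ A := tensorRightHomEquiv B A' A (𝟙_ C) q ≫ (λ_ A).hom
  have hg : g ▷ A' ≫ (β_ A A').hom ≫ ExactPairing.evaluation A A' = q := by
    have h := (tensorRightHomEquiv B A' A (𝟙_ C)).symm_apply_apply q
    conv_rhs => rw [← h]
    change _ = tensorRightHomEquiv B A' A (𝟙_ C) q ▷ A' ≫ (α_ (𝟙_ C) A A').hom ≫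
      𝟙_ C ◁ ((β_ A A').hom ≫ ExactPairing.evaluation A A') ≫ (ρ_ (𝟙_ C)).hom
    simp only [g]
    monoidal
  refine ⟨g, ?_⟩
  rw [quantumTrace, comp_whiskerRight, Category.assoc, hg]
  simp only [q]
  rwa [← whisker_exchange_assoc, reassoc_of% ht]

omit [HasBinaryBiproducts C] [IsIdempotentComplete C] [MonoidalPreadditive C] in
lemma IsNull.quantumTrace_eq_zero {A A' : C} [ExactPairing A A'] {f : A ⟶ A} (hf : IsNull f) :
    quantumTrace A A' f = 0 :=
  hf A' _ _

/-- A non-null morphism `f` out of a rigid `A` has a composite `f ≫ g` of nonzero trace. As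
non-invertible endomorphisms of `A` are null, `f ≫ g` is invertible, and `f` is a split
monomorphism to an indecomposable object. -/
lemma isIso_of_not_isNull (finite_hom : ∀ X Y : C, Module.Finite k (X ⟶ Y))
    (end_unit : Function.Bijective fun c : k => c • 𝟙 (𝟙_ C)) {A B : C} (hA : Indecomposable A)
    (hB : Indecomposable B) (growth : HasModerateGrowth k A) {f : A ⟶ B} (hf : ¬ IsNull f) :
    IsIso f := by
  have h1 : ¬ IsNull (𝟙 A) := fun h => hf (by simpa using h.comp_right f)
  obtain ⟨⟨A', ⟨_⟩⟩, hnull⟩ := exists_exactPairing_and_isNull finite_hom end_unit hA h1 growth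
  obtain ⟨g, hg⟩ := exists_quantumTrace_ne_zero (A' := A') hf
  have hfg : IsIso (f ≫ g) := by
    by_contra h
    exact hg (hnull _ h).quantumTrace_eq_zero
  have h2 : f ≫ g ≫ inv (f ≫ g) = 𝟙 A := by rw [← Category.assoc, IsIso.hom_inv_id]
  rcases indecomposable_eq_zero_or_id_of_idem hB ((g ≫ inv (f ≫ g)) ≫ f) (by
    simp only [Category.assoc] at *
    rw [reassoc_of% h2]) with h | h
  · refine absurd ?_ hf
    have : f = 0 := by
      calc f = (f ≫ g ≫ inv (f ≫ g)) ≫ f := by rw [h2, Category.id_comp]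
        _ = f ≫ ((g ≫ inv (f ≫ g)) ≫ f) := by simp
        _ = 0 := by rw [h, comp_zero]
    rw [this]
    exact IsNull.zero A B
  · exact ⟨g ≫ inv (f ≫ g), h2, h⟩

/-- Negligible morphisms, which are defined by traces over rigid objects, are the null morphisms. -/
theorem isNegligibleMorphism_iff_isNull [HasZeroObject C]
    (finite_hom : ∀ X Y : C, Module.Finite k (X ⟶ Y))
    (end_unit : Function.Bijective fun c : k => c • 𝟙 (𝟙_ C))
    (growth : CategoryHasModerateGrowth k C) {X Y : C} (f : X ⟶ Y) :
    IsNegligibleMorphism f ↔ IsNull f := by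
  constructor
  · contrapose
    suffices H : ∀ (f : X ⟶ Y), ¬ IsNull f → ∃ (W W' : C) (_ : ExactPairing W W') (a : W ⟶ X)
        (b : Y ⟶ W), quantumTrace W W' (a ≫ f ≫ b) ≠ 0 by
      intro hf hn
      obtain ⟨W, W', _, a, b, h⟩ := H f hf
      exact h (hn W W' a b)
    clear f
    induction X using induction_indecomposable k finite_hom with
    | zero X hX =>
      intro f hf
      refine absurd ?_ hf
      rw [hX.eq_of_src f 0]
      exact IsNull.zero X Y
    | indecomposable X hX =>
      intro f hf
      obtain ⟨⟨X', ⟨_⟩⟩, -⟩ := exists_exactPairing_and_isNull finite_hom end_unit hX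
        (fun h => hf (by simpa using h.comp_right f)) (growth X hX)
      obtain ⟨g, hg⟩ := exists_quantumTrace_ne_zero (A' := X') hf
      exact ⟨X, X', inferInstance, 𝟙 X, g, by simpa using hg⟩
    | iso X Z e ih =>
      intro f hf
      obtain ⟨W, W', _, a, b, h⟩ := ih (e.hom ≫ f)
        (fun h => hf (by simpa using h.comp_left e.inv))
      exact ⟨W, W', inferInstance, a ≫ e.hom, b, by simpa using h⟩
    | sum X Z ihX ihZ =>
      intro f hf
      have hsum : f = biprod.fst ≫ biprod.inl ≫ f + biprod.snd ≫ biprod.inr ≫ f := by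
        rw [← Category.assoc, ← Category.assoc, ← Preadditive.add_comp, biprod.total,
          Category.id_comp]
      by_cases h1 : IsNull (biprod.inl ≫ f)
      · obtain ⟨W, W', _, a, b, h⟩ := ihZ (biprod.inr ≫ f) (fun h2 => hf (by
          rw [hsum]
          exact (h1.comp_left _).add (h2.comp_left _)))
        exact ⟨W, W', inferInstance, a ≫ biprod.inr, b, by simpa using h⟩
      · obtain ⟨W, W', _, a, b, h⟩ := ihX (biprod.inl ≫ f) h1
        exact ⟨W, W', inferInstance, a ≫ biprod.inl, b, by simpa using h⟩
  · intro hf W W' _ a b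
    exact ((hf.comp_right b).comp_left a).quantumTrace_eq_zero

end Growth

/-! ### Semisimple additive categories -/

section Semisimple

variable {D : Type u} [Category.{v} D] [Preadditive D] [HasFiniteBiproducts D]

/-- `P` is a class of nonzero objects such that all nonzero morphisms between them are invertible,
and every object is a finite direct sum of objects in `P`. -/
structure IsSemisimpleClass (P : D → Prop) : Prop where
  id_ne_zero {S : D} : P S → 𝟙 S ≠ 0
  isIso {S T : D} : P S → P T → ∀ f : S ⟶ T, f ≠ 0 → IsIso f
  decomposition (X : D) : ∃ (n : ℕ) (S : Fin n → D), (∀ i, P (S i)) ∧ Nonempty (X ≅ ⨁ S)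

namespace IsSemisimpleClass

variable {P : D → Prop} (hP : IsSemisimpleClass P)

include hP

lemma exists_retraction {S Y : D} (hS : P S) (s : S ⟶ Y) (hs : s ≠ 0) :
    ∃ r : Y ⟶ S, s ≫ r = 𝟙 S := by
  obtain ⟨n, T, hT, ⟨e⟩⟩ := hP.decomposition Y
  obtain ⟨j, hj⟩ : ∃ j, s ≫ e.hom ≫ biproduct.π T j ≠ 0 := by
    by_contra! h
    apply hs
    rw [← cancel_mono e.hom, zero_comp]
    ext j
    simpa using h j
  have := hP.isIso hS (hT j) _ hj
  exact ⟨(e.hom ≫ biproduct.π T j) ≫ inv (s ≫ e.hom ≫ biproduct.π T j), by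
    rw [← Category.assoc, IsIso.hom_inv_id]⟩

/-- Gaussian elimination: the objects `S i` that map to `Y` by `s i` generate a direct summand
`U` of `Y`. -/
lemma exists_summand {Y : D} {n : ℕ} {S : Fin n → D} (hS : ∀ i, P (S i))
    (s : (i : Fin n) → (S i ⟶ Y)) :
    ∃ (U : D) (t : U ⟶ Y) (g : Y ⟶ U) (c : (i : Fin n) → (Y ⟶ S i)), t ≫ g = 𝟙 U ∧
      (∀ i, s i ≫ g ≫ t = s i) ∧ g ≫ t = ∑ i, c i ≫ s i := by
  induction n with
  | zero =>
    have := hasZeroObject_of_hasFiniteBiproducts D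
    obtain ⟨Z, hZ⟩ := HasZeroObject.zero (C := D)
    exact ⟨Z, 0, 0, fun i => i.elim0, hZ.eq_of_src _ _, fun i => i.elim0, by simp⟩
  | succ n ih =>
    obtain ⟨U, t, g, c, htg, hsg, hgt⟩ := ih (fun i => hS i.castSucc) (fun i => s i.castSucc)
    by_cases h0 : s (Fin.last n) ≫ (𝟙 Y - g ≫ t) = 0
    · refine ⟨U, t, g, Fin.lastCases 0 c, htg, fun i => Fin.lastCases ?_ hsg i, ?_⟩
      · rw [Fin.sum_univ_castSucc]
        simp [hgt]
      · rw [Preadditive.comp_sub, Category.comp_id, sub_eq_zero] at h0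
        exact h0.symm
    · obtain ⟨r, hr⟩ := hP.exists_retraction (hS _) _ h0
      have hr : s (Fin.last n) ≫ (𝟙 Y - g ≫ t) ≫ r = 𝟙 _ := by simpa using hr
      have : HasBinaryBiproducts D := hasBinaryBiproducts_of_finite_biproducts D
      -- the new summand is spanned by the component of the last map that is killed by `g`
      let t' : S (Fin.last n) ⟶ Y := s (Fin.last n) ≫ (𝟙 Y - g ≫ t)
      let g' : Y ⟶ S (Fin.last n) := (𝟙 Y - g ≫ t) ≫ r
      have ht'g : t' ≫ g = 0 := by simp [t', htg]
      have htg' : t ≫ g' = 0 := by simp [g', Preadditive.sub_comp, reassoc_of% htg]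
      have ht'g' : t' ≫ g' = 𝟙 _ := by
        have : (𝟙 Y - g ≫ t) ≫ (𝟙 Y - g ≫ t) = 𝟙 Y - g ≫ t := by
          simp [Preadditive.sub_comp, reassoc_of% htg]
        simp only [t', g', Category.assoc]
        rw [reassoc_of% this, hr]
      refine ⟨U ⊞ S (Fin.last n), biprod.desc t t', biprod.lift g g',
        Fin.lastCases (g' : Y ⟶ S (Fin.last n))
          (fun i => (𝟙 Y - g' ≫ s (Fin.last n)) ≫ c i), ?_, ?_, ?_⟩
      · ext <;> simp [htg, ht'g, htg', ht'g']
      · have h1 : s (Fin.last n) ≫ g' = 𝟙 _ := hr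
        refine Fin.lastCases ?_ fun i => ?_
        · rw [biprod.lift_desc, Preadditive.comp_add, reassoc_of% h1]
          simp [t']
        · have h2 : s i.castSucc ≫ g' = 0 := by
            simp only [g', Preadditive.sub_comp, Preadditive.comp_sub, Category.assoc,
              Category.id_comp]
            rw [reassoc_of% hsg i, sub_self]
          rw [biprod.lift_desc, Preadditive.comp_add, reassoc_of% h2, hsg]
          simp
      · rw [Fin.sum_univ_castSucc]
        simp only [Fin.lastCases_castSucc, Fin.lastCases_last, Category.assoc, biprod.lift_desc]
        rw [← Preadditive.comp_sum, ← hgt]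
        simp [t']
        abel

/-- Every morphism has an image, which is a direct summand, and is regular: `f ≫ G ≫ f = f`. -/
lemma exists_image {X Y : D} (f : X ⟶ Y) : ∃ (U : D) (t : U ⟶ Y) (g : Y ⟶ U) (G : Y ⟶ X),
    t ≫ g = 𝟙 U ∧ f ≫ g ≫ t = f ∧ g ≫ t = G ≫ f := by
  obtain ⟨n, S, hS, ⟨e⟩⟩ := hP.decomposition X
  obtain ⟨U, t, g, c, htg, hsg, hgt⟩ := hP.exists_summand hS
    (fun i => biproduct.ι S i ≫ e.inv ≫ f)
  refine ⟨U, t, g, ∑ i, c i ≫ biproduct.ι S i ≫ e.inv, htg, ?_, ?_⟩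
  · rw [← cancel_epi e.inv]
    ext i
    simpa using hsg i
  · rw [hgt, Preadditive.sum_comp]
    simp

lemma exists_regular {X Y : D} (f : X ⟶ Y) : ∃ G : Y ⟶ X, f ≫ G ≫ f = f := by
  obtain ⟨U, t, g, G, -, h1, h2⟩ := hP.exists_image f
  exact ⟨G, by rw [← h2, h1]⟩

lemma isIdempotentComplete : IsIdempotentComplete D where
  idempotents_split X p hp := by
    obtain ⟨U, t, g, G, htg, h1, h2⟩ := hP.exists_image p
    have h3 : t ≫ p = t := by
      have : t = t ≫ G ≫ p := by rw [← h2, ← Category.assoc, htg, Category.id_comp]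
      rw [this]
      simp [hp]
    exact ⟨U, t, p ≫ g, by rw [reassoc_of% h3, htg], by rw [Category.assoc, h1]⟩

lemma hasKernels : HasKernels D where
  has_limit {X Y} f := by
    have := hP.isIdempotentComplete
    obtain ⟨G, hG⟩ := hP.exists_regular f
    obtain ⟨K, i, r, hir, hri⟩ := IsIdempotentComplete.idempotents_split X (𝟙 X - f ≫ G)
      (by simp [Preadditive.sub_comp, reassoc_of% hG])
    have hif : i ≫ f = 0 := by
      rw [← Category.id_comp i, ← hir, Category.assoc, Category.assoc, reassoc_of% hri]
      simp [Preadditive.sub_comp, hG]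
    refine ⟨⟨KernelFork.ofι i hif, KernelFork.IsLimit.ofι i hif (fun x _ => x ≫ r) ?_ ?_⟩⟩
    · intro W x hx
      rw [Category.assoc, hri, Preadditive.comp_sub, reassoc_of% hx]
      simp
    · intro W x hx m hm
      rw [← hm, Category.assoc, hir, Category.comp_id]

lemma hasCokernels : HasCokernels D where
  has_colimit {X Y} f := by
    have := hP.isIdempotentComplete
    obtain ⟨G, hG⟩ := hP.exists_regular f
    obtain ⟨K, i, r, hir, hri⟩ := IsIdempotentComplete.idempotents_split Y (𝟙 Y - G ≫ f)
      (by simp [Preadditive.comp_sub, hG])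
    have hfr : f ≫ r = 0 := by
      rw [← Category.comp_id r, ← hir, reassoc_of% hri]
      simp [Preadditive.sub_comp, reassoc_of% hG]
    refine ⟨⟨CokernelCofork.ofπ r hfr, CokernelCofork.IsColimit.ofπ r hfr (fun x _ => i ≫ x) ?_ ?_⟩⟩
    · intro W x hx
      rw [reassoc_of% hri, Preadditive.sub_comp, Category.assoc, hx]
      simp
    · intro W x hx m hm
      rw [← hm, reassoc_of% hir]

/-- A semisimple additive category is abelian: all monomorphisms and epimorphisms split. -/
noncomputable abbrev abelian : Abelian D :=
  have := hP.hasKernels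
  have := hP.hasCokernels
  { normalMonoOfMono := fun {X Y} f _ => by
      obtain ⟨G, hG⟩ := hP.exists_regular f
      have hfG : f ≫ G = 𝟙 X := by
        rw [← cancel_mono f, Category.assoc, hG, Category.id_comp]
      refine ⟨⟨Y, 𝟙 Y - G ≫ f, by simp [Preadditive.comp_sub, reassoc_of% hfG],
        KernelFork.IsLimit.ofι _ _ (fun x _ => x ≫ G) ?_ ?_⟩⟩
      · intro W x hx
        rw [Preadditive.comp_sub, Category.comp_id, sub_eq_zero] at hx
        simpa using hx.symm
      · intro W x hx m hm
        rw [← hm, Category.assoc, hfG, Category.comp_id]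
    normalEpiOfEpi := fun {X Y} f _ => by
      obtain ⟨G, hG⟩ := hP.exists_regular f
      have hGf : G ≫ f = 𝟙 Y := by
        rw [← cancel_epi f, hG, Category.comp_id]
      refine ⟨⟨X, 𝟙 X - f ≫ G, by simp [Preadditive.sub_comp, hGf],
        CokernelCofork.IsColimit.ofπ _ _ (fun x _ => G ≫ x) ?_ ?_⟩⟩
      · intro W x hx
        rw [Preadditive.sub_comp, Category.id_comp, sub_eq_zero] at hx
        simpa using hx.symm
      · intro W x hx m hm
        rw [← hm, reassoc_of% hGf] }

lemma simple {S : D} (hS : P S) : Simple S where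
  mono_isIso_iff_nonzero {Y} f _ := by
    refine ⟨fun h hf => ?_, fun hf => ?_⟩
    · apply hP.id_ne_zero hS
      have h1 : inv f ≫ f = 0 := (congrArg (inv f ≫ ·) hf).trans comp_zero
      rw [← h1, IsIso.inv_hom_id]
    · obtain ⟨G, hG⟩ := hP.exists_regular f
      have hfG : f ≫ G = 𝟙 Y := by
        rw [← cancel_mono f, Category.assoc, hG, Category.id_comp]
      have := hP.isIso hS hS (G ≫ f) (fun h => hf (by rw [← hG, h, comp_zero]))
      refine ⟨G, hfG, ?_⟩
      rw [← cancel_mono (G ≫ f), Category.assoc, reassoc_of% hfG, Category.id_comp]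

/-- Every simple object is isomorphic to an object of `P`. -/
lemma exists_iso_of_simple {S : D} [Simple S] : ∃ T, P T ∧ Nonempty (T ≅ S) := by
  obtain ⟨n, T, hT, ⟨e⟩⟩ := hP.decomposition S
  obtain ⟨j, hj⟩ : ∃ j, biproduct.ι T j ≫ e.inv ≠ 0 := by
    by_contra! h
    apply id_nonzero S
    rw [← e.hom_inv_id]
    have : e.inv = 0 := by
      ext j
      simpa using h j
    rw [this, comp_zero]
  obtain ⟨r, hr⟩ := hP.exists_retraction (hT j) _ hj
  have : Mono (biproduct.ι T j ≫ e.inv) := mono_of_mono_fac hr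
  have := isIso_of_mono_of_nonzero hj
  exact ⟨T j, hT j, ⟨asIso (biproduct.ι T j ≫ e.inv)⟩⟩

lemma exists_iso_of_indecomposable [HasBinaryBiproducts D] {Z : D} (hZ : Indecomposable Z) :
    ∃ T, P T ∧ Nonempty (T ≅ Z) := by
  have := hP.isIdempotentComplete
  obtain ⟨n, T, hT, ⟨e⟩⟩ := hP.decomposition Z
  obtain ⟨j, hj⟩ : ∃ j, biproduct.ι T j ≫ e.inv ≠ 0 := by
    by_contra! h
    apply hZ.1
    rw [IsZero.iff_id_eq_zero, ← e.hom_inv_id]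
    have : e.inv = 0 := by
      ext j
      simpa using h j
    rw [this, comp_zero]
  obtain ⟨r, hr⟩ := hP.exists_retraction (hT j) _ hj
  rcases indecomposable_eq_zero_or_id_of_idem hZ (r ≫ biproduct.ι T j ≫ e.inv) (by
    rw [Category.assoc, ← Category.assoc _ r, hr, Category.id_comp]) with h | h
  · refine absurd ?_ hj
    rw [← Category.id_comp (_ ≫ _), ← hr, Category.assoc, h, comp_zero]
  · exact ⟨T j, hT j, ⟨⟨_, r, hr, h⟩⟩⟩

end IsSemisimpleClass

end Semisimple

/-! ### The quotient by the null morphisms -/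

section NullQuotient

variable (C : Type u) [Category.{v} C] [MonoidalCategory C] [Preadditive C]
  [MonoidalPreadditive C]

/-- Equality modulo null morphisms. -/
def nullRel : HomRel C := fun _ _ f g => IsNull (f - g)

instance : Congruence (nullRel C) where
  equivalence :=
    { refl := fun f => by
        simpa [nullRel] using IsNull.zero _ _
      symm := fun {f g} h => by
        simpa [nullRel] using IsNull.neg h
      trans := fun {f g h} h1 h2 => by
        simpa [nullRel] using IsNull.add h1 h2 }
  comp_left {_ _ _} f {g g'} h := by
    simpa [nullRel] using IsNull.comp_left f h
  comp_right {_ _ _} _ _ g h := by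
    simpa [nullRel] using IsNull.comp_right h g

/-- The quotient of `C` by the tensor ideal of null morphisms. -/
abbrev NullQuotient : Type u := Quotient (nullRel C)

/-- The quotient functor. -/
abbrev toNullQuotient : C ⥤ NullQuotient C := Quotient.functor (nullRel C)

variable {C} in
lemma toNullQuotient_map_eq_iff {X Y : C} (f g : X ⟶ Y) :
    (toNullQuotient C).map f = (toNullQuotient C).map g ↔ IsNull (f - g) :=
  Quotient.functor_map_eq_iff (nullRel C) f g

lemma nullRel_add ⦃X Y : C⦄ (f₁ f₂ g₁ g₂ : X ⟶ Y) (h : nullRel C f₁ f₂) (h' : nullRel C g₁ g₂) :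
    nullRel C (f₁ + g₁) (f₂ + g₂) := by
  have := IsNull.add h h'
  rwa [sub_add_sub_comm] at this

instance : Preadditive (NullQuotient C) := Quotient.preadditive _ (nullRel_add C)

instance : (toNullQuotient C).Additive := Quotient.functor_additive _ (nullRel_add C)

variable {C} in
lemma toNullQuotient_map_eq_zero_iff {X Y : C} (f : X ⟶ Y) :
    (toNullQuotient C).map f = 0 ↔ IsNull f := by
  rw [← (toNullQuotient C).map_zero, toNullQuotient_map_eq_iff, sub_zero]

section Linear

variable (k : Type w) [Field k] [Linear k C] [MonoidalLinear k C]

lemma nullRel_smul (a : k) ⦃X Y : C⦄ (f₁ f₂ : X ⟶ Y) (h : nullRel C f₁ f₂) :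
    nullRel C (a • f₁) (a • f₂) := by
  have := IsNull.smul a h
  rwa [smul_sub] at this

instance : Linear k (NullQuotient C) := Quotient.linear k _ (nullRel_smul C k)

instance : (toNullQuotient C).Linear k := Quotient.linear_functor k _ (nullRel_smul C k)

end Linear

variable {C} [BraidedCategory C]

/-- Left whiskering of a class of morphisms. -/
def quotWhiskerLeft (X : NullQuotient C) {Y Z : NullQuotient C} (f : Y ⟶ Z) :
    (⟨X.as ⊗ Y.as⟩ : NullQuotient C) ⟶ ⟨X.as ⊗ Z.as⟩ :=
  Quot.lift (fun f => (toNullQuotient C).map (X.as ◁ f)) (fun f g h => by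
    rw [toNullQuotient_map_eq_iff]
    have := IsNull.whiskerLeft ((HomRel.compClosure_iff_self _ _ _).mp h) X.as
    have h2 : X.as ◁ (f - g) = X.as ◁ f - X.as ◁ g := (tensorLeft X.as).map_sub
    rwa [h2] at this) f

/-- Right whiskering of a class of morphisms. -/
def quotWhiskerRight {Y Z : NullQuotient C} (f : Y ⟶ Z) (X : NullQuotient C) :
    (⟨Y.as ⊗ X.as⟩ : NullQuotient C) ⟶ ⟨Z.as ⊗ X.as⟩ :=
  Quot.lift (fun f => (toNullQuotient C).map (f ▷ X.as)) (fun f g h => by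
    rw [toNullQuotient_map_eq_iff]
    have := IsNull.whiskerRight ((HomRel.compClosure_iff_self _ _ _).mp h) X.as
    have h2 : (f - g) ▷ X.as = f ▷ X.as - g ▷ X.as := (tensorRight X.as).map_sub
    rwa [h2] at this) f

instance : MonoidalCategoryStruct (NullQuotient C) where
  tensorObj X Y := ⟨X.as ⊗ Y.as⟩
  whiskerLeft X _ _ f := quotWhiskerLeft X f
  whiskerRight f X := quotWhiskerRight f X
  tensorHom {_ Y₁ X₂ _} f g := quotWhiskerRight f X₂ ≫ quotWhiskerLeft Y₁ g
  tensorUnit := ⟨𝟙_ C⟩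
  associator X Y Z := (toNullQuotient C).mapIso (α_ X.as Y.as Z.as)
  leftUnitor X := (toNullQuotient C).mapIso (λ_ X.as)
  rightUnitor X := (toNullQuotient C).mapIso (ρ_ X.as)

instance : MonoidalCategory (NullQuotient C) where
  tensorHom_def _ _ := rfl
  id_tensorHom_id X Y := by
    refine Eq.trans (congrArg (toNullQuotient C).map
      (show (𝟙 X.as ▷ Y.as) ≫ (X.as ◁ 𝟙 Y.as) = 𝟙 (X.as ⊗ Y.as) by simp)) ?_
    exact (toNullQuotient C).map_id _
  tensorHom_comp_tensorHom := by
    rintro X₁ Y₁ Z₁ X₂ Y₂ Z₂ ⟨f₁⟩ ⟨f₂⟩ ⟨g₁⟩ ⟨g₂⟩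
    refine congrArg (toNullQuotient C).map
      (show (f₁ ▷ X₂.as ≫ Y₁.as ◁ f₂) ≫ (g₁ ▷ Y₂.as ≫ Z₁.as ◁ g₂) =
        (f₁ ≫ g₁) ▷ X₂.as ≫ Z₁.as ◁ (f₂ ≫ g₂) from ?_)
    simp [whisker_exchange_assoc]
  whiskerLeft_id X Y := congrArg (toNullQuotient C).map (MonoidalCategory.whiskerLeft_id X.as Y.as)
  id_whiskerRight X Y :=
    congrArg (toNullQuotient C).map (MonoidalCategory.id_whiskerRight X.as Y.as)
  associator_naturality := by
    rintro X₁ X₂ X₃ Y₁ Y₂ Y₃ ⟨f₁⟩ ⟨f₂⟩ ⟨f₃⟩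
    refine congrArg (toNullQuotient C).map
      (show ((f₁ ▷ X₂.as ≫ Y₁.as ◁ f₂) ▷ X₃.as ≫ (Y₁.as ⊗ Y₂.as) ◁ f₃) ≫ (α_ _ _ _).hom =
        (α_ X₁.as X₂.as X₃.as).hom ≫ f₁ ▷ (X₂.as ⊗ X₃.as) ≫
          Y₁.as ◁ (f₂ ▷ X₃.as ≫ Y₂.as ◁ f₃) from ?_)
    simp
  leftUnitor_naturality := by
    rintro X Y ⟨f⟩
    exact congrArg (toNullQuotient C).map (MonoidalCategory.leftUnitor_naturality f)
  rightUnitor_naturality := by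
    rintro X Y ⟨f⟩
    exact congrArg (toNullQuotient C).map (MonoidalCategory.rightUnitor_naturality f)
  pentagon W X Y Z := congrArg (toNullQuotient C).map
    (MonoidalCategory.pentagon W.as X.as Y.as Z.as)
  triangle X Y := congrArg (toNullQuotient C).map (MonoidalCategory.triangle X.as Y.as)

instance : BraidedCategory (NullQuotient C) where
  braiding X Y := (toNullQuotient C).mapIso (β_ X.as Y.as)
  braiding_naturality_right X _ _ := by
    rintro ⟨f⟩
    exact congrArg (toNullQuotient C).map (BraidedCategory.braiding_naturality_right X.as f)
  braiding_naturality_left := by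
    rintro X Y ⟨f⟩ Z
    exact congrArg (toNullQuotient C).map (BraidedCategory.braiding_naturality_left f Z.as)
  hexagon_forward X Y Z := congrArg (toNullQuotient C).map
    (BraidedCategory.hexagon_forward X.as Y.as Z.as)
  hexagon_reverse X Y Z := congrArg (toNullQuotient C).map
    (BraidedCategory.hexagon_reverse X.as Y.as Z.as)

instance : MonoidalPreadditive (NullQuotient C) where
  whiskerLeft_zero {X Y Z} := congrArg (toNullQuotient C).map
    (MonoidalPreadditive.whiskerLeft_zero (X := X.as) (Y := Y.as) (Z := Z.as))
  zero_whiskerRight {X Y Z} := congrArg (toNullQuotient C).map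
    (MonoidalPreadditive.zero_whiskerRight (X := X.as) (Y := Y.as) (Z := Z.as))
  whiskerLeft_add := by
    rintro X Y Z ⟨f⟩ ⟨g⟩
    exact congrArg (toNullQuotient C).map (MonoidalPreadditive.whiskerLeft_add (X := X.as) f g)
  add_whiskerRight := by
    rintro X Y Z ⟨f⟩ ⟨g⟩
    exact congrArg (toNullQuotient C).map (MonoidalPreadditive.add_whiskerRight (X := X.as) f g)

instance (k : Type w) [Field k] [Linear k C] [MonoidalLinear k C] :
    MonoidalLinear k (NullQuotient C) where
  whiskerLeft_smul := by
    rintro X Y Z r ⟨f⟩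
    exact congrArg (toNullQuotient C).map (MonoidalLinear.whiskerLeft_smul X.as r f)
  smul_whiskerRight := by
    rintro r Y Z ⟨f⟩ X
    exact congrArg (toNullQuotient C).map (MonoidalLinear.smul_whiskerRight r f X.as)

instance : (toNullQuotient C).Monoidal :=
  Functor.CoreMonoidal.toMonoidal
    { εIso := Iso.refl _
      μIso := fun _ _ => Iso.refl _
      μIso_hom_natural_left := fun f X => by
        refine (Category.comp_id _).trans ?_
        exact (Category.id_comp _).symm
      μIso_hom_natural_right := fun X f => by
        refine (Category.comp_id _).trans ?_
        exact (Category.id_comp _).symm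
      associativity := fun X Y Z => congrArg (toNullQuotient C).map
        (show 𝟙 (X ⊗ Y) ▷ Z ≫ 𝟙 ((X ⊗ Y) ⊗ Z) ≫ (α_ X Y Z).hom =
          (α_ X Y Z).hom ≫ X ◁ 𝟙 (Y ⊗ Z) ≫ 𝟙 (X ⊗ (Y ⊗ Z)) by simp)
      left_unitality := fun X => congrArg (toNullQuotient C).map
        (show (λ_ X).hom = 𝟙 (𝟙_ C) ▷ X ≫ 𝟙 (𝟙_ C ⊗ X) ≫ (λ_ X).hom by simp)
      right_unitality := fun X => congrArg (toNullQuotient C).map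
        (show (ρ_ X).hom = X ◁ 𝟙 (𝟙_ C) ≫ 𝟙 (X ⊗ 𝟙_ C) ≫ (ρ_ X).hom by simp) }

instance : (toNullQuotient C).Braided where
  braided X Y := congrArg (toNullQuotient C).map
    (show 𝟙 (X ⊗ Y) ≫ (β_ X Y).hom = (β_ X Y).hom ≫ 𝟙 (Y ⊗ X) by simp)

end NullQuotient

/-! ### Semisimplicity of the quotient -/

section FiniteBiproducts

variable {D : Type u} [Category.{v} D] [Preadditive D]

lemma nonempty_biprod_iso_biproduct [HasFiniteBiproducts D] [HasBinaryBiproducts D] {m n : ℕ}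
    {S : Fin m → D} {T : Fin n → D} : Nonempty ((⨁ S) ⊞ (⨁ T) ≅ ⨁ (Sum.elim S T ∘
      (finSumFinEquiv (m := m) (n := n)).symm)) := by
  classical
  let b : Bicone (Sum.elim S T) :=
    { pt := (⨁ S) ⊞ (⨁ T)
      π := fun j => match j with
        | Sum.inl i => biprod.fst ≫ biproduct.π S i
        | Sum.inr i => biprod.snd ≫ biproduct.π T i
      ι := fun j => match j with
        | Sum.inl i => biproduct.ι S i ≫ biprod.inl
        | Sum.inr i => biproduct.ι T i ≫ biprod.inr
      ι_π := by
        rintro (i | i) (j | j)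
        · by_cases h : i = j
          · subst h; simp; rfl
          · simp [h]; rfl
        · simp; rfl
        · simp; rfl
        · by_cases h : i = j
          · subst h; simp; rfl
          · simp [h]; rfl }
  have hb : b.IsBilimit := isBilimitOfTotal b (by
    rw [Fintype.sum_sum_type]
    have h1 : ∑ i, (biprod.fst ≫ biproduct.π S i) ≫ biproduct.ι S i ≫ biprod.inl =
        (biprod.fst ≫ biprod.inl : (⨁ S) ⊞ (⨁ T) ⟶ (⨁ S) ⊞ (⨁ T)) := by
      have := congrArg (fun x => (biprod.fst : (⨁ S) ⊞ (⨁ T) ⟶ _) ≫ x ≫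
          (biprod.inl : _ ⟶ (⨁ S) ⊞ (⨁ T)))
        (biproduct.total (f := S))
      simpa only [Preadditive.comp_sum, Preadditive.sum_comp, Category.assoc, Category.id_comp]
        using this
    have h2 : ∑ i, (biprod.snd ≫ biproduct.π T i) ≫ biproduct.ι T i ≫ biprod.inr =
        (biprod.snd ≫ biprod.inr : (⨁ S) ⊞ (⨁ T) ⟶ (⨁ S) ⊞ (⨁ T)) := by
      have := congrArg (fun x => (biprod.snd : (⨁ S) ⊞ (⨁ T) ⟶ _) ≫ x ≫
          (biprod.inr : _ ⟶ (⨁ S) ⊞ (⨁ T)))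
        (biproduct.total (f := T))
      simpa only [Preadditive.comp_sum, Preadditive.sum_comp, Category.assoc, Category.id_comp]
        using this
    exact (congrArg₂ (· + ·) h1 h2).trans biprod.total)
  exact ⟨biproduct.uniqueUpToIso _ hb ≪≫ (biproduct.reindex finSumFinEquiv.symm _).symm⟩

/-- Being a finite direct sum of objects in `P`. -/
def IsFiniteSum [HasFiniteBiproducts D] (P : D → Prop) (X : D) : Prop :=
  ∃ (n : ℕ) (S : Fin n → D), (∀ i, P (S i)) ∧ Nonempty (X ≅ ⨁ S)

variable [HasFiniteBiproducts D] {P : D → Prop}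

lemma IsFiniteSum.of_iso {X Y : D} (h : IsFiniteSum P X) (e : Y ≅ X) : IsFiniteSum P Y := by
  obtain ⟨n, S, hS, ⟨e'⟩⟩ := h
  exact ⟨n, S, hS, ⟨e ≪≫ e'⟩⟩

lemma isFiniteSum_of_isZero {X : D} (h : IsZero X) : IsFiniteSum P X := by
  refine ⟨0, fun i => i.elim0, fun i => i.elim0, ⟨h.iso ?_⟩⟩
  rw [IsZero.iff_id_eq_zero]
  ext i
  exact i.elim0

lemma isFiniteSum_of_mem {X : D} (h : P X) : IsFiniteSum P X :=
  ⟨1, fun _ => X, fun _ => h, ⟨(biproductUniqueIso (fun _ : Fin 1 => X)).symm⟩⟩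

lemma IsFiniteSum.biprod [HasBinaryBiproducts D] {X Y : D} (hX : IsFiniteSum P X)
    (hY : IsFiniteSum P Y) : IsFiniteSum P (X ⊞ Y) := by
  obtain ⟨m, S, hS, ⟨e⟩⟩ := hX
  obtain ⟨n, T, hT, ⟨e'⟩⟩ := hY
  obtain ⟨e''⟩ := nonempty_biprod_iso_biproduct (S := S) (T := T)
  refine ⟨m + n, _, fun i => ?_, ⟨biprod.mapIso e e' ≪≫ e''⟩⟩
  rcases h : (finSumFinEquiv (m := m) (n := n)).symm i with j | j
  · simpa [h] using hS j
  · simpa [h] using hT j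

end FiniteBiproducts

section NullQuotient

variable {C : Type u} [Category.{v} C] [MonoidalCategory C] [Preadditive C]
  [MonoidalPreadditive C]

lemma isZero_map_iff {X : C} : IsZero ((toNullQuotient C).obj X) ↔ IsNull (𝟙 X) := by
  rw [IsZero.iff_id_eq_zero, ← toNullQuotient_map_eq_zero_iff, CategoryTheory.Functor.map_id]

variable [HasBinaryBiproducts C]

/-- The image of a direct sum in the quotient. -/
noncomputable def quotBinaryBicone (X Y : NullQuotient C) : BinaryBicone X Y where
  pt := (toNullQuotient C).obj (X.as ⊞ Y.as)
  fst := (toNullQuotient C).map biprod.fst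
  snd := (toNullQuotient C).map biprod.snd
  inl := (toNullQuotient C).map biprod.inl
  inr := (toNullQuotient C).map biprod.inr
  inl_fst := congrArg (toNullQuotient C).map biprod.inl_fst
  inl_snd := congrArg (toNullQuotient C).map biprod.inl_snd
  inr_fst := congrArg (toNullQuotient C).map biprod.inr_fst
  inr_snd := congrArg (toNullQuotient C).map biprod.inr_snd

instance : HasBinaryBiproducts (NullQuotient C) where
  has_binary_biproduct X Y := hasBinaryBiproduct_of_total (quotBinaryBicone X Y)
    (congrArg (toNullQuotient C).map (biprod.total (X := X.as) (Y := Y.as)))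

lemma nonempty_map_biprod_iso (X Y : C) : Nonempty ((toNullQuotient C).obj (X ⊞ Y) ≅
    (toNullQuotient C).obj X ⊞ (toNullQuotient C).obj Y) :=
  have := preservesBinaryBiproducts_of_preservesBiproducts (toNullQuotient C)
  ⟨(toNullQuotient C).mapBiprod X Y⟩

variable [HasZeroObject C]

instance : HasZeroObject (NullQuotient C) := by
  obtain ⟨Z, hZ⟩ := HasZeroObject.zero (C := C)
  exact ⟨(toNullQuotient C).obj Z, (toNullQuotient C).map_isZero hZ⟩

instance : HasFiniteBiproducts (NullQuotient C) :=
  have : HasFiniteProducts (NullQuotient C) := hasFiniteProducts_of_has_binary_and_terminal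
  HasFiniteBiproducts.of_hasFiniteProducts

end NullQuotient

section Semisimple

variable {C : Type u} [Category.{v} C] [Preadditive C] [HasBinaryBiproducts C]
  [MonoidalCategory C] [BraidedCategory C] [MonoidalPreadditive C]

/-- The objects of the quotient that come from non-negligible objects of `C`. -/
def FromNonNegligible (T : NullQuotient C) : Prop :=
  ∃ X : C, IsNonNegligible X ∧ Nonempty ((toNullQuotient C).obj X ≅ T)

variable [IsIdempotentComplete C] {k : Type w} [Field k] [Linear k C] [MonoidalLinear k C]

lemma isIso_of_map_ne_zero (finite_hom : ∀ X Y : C, Module.Finite k (X ⟶ Y))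
    (end_unit : Function.Bijective fun c : k => c • 𝟙 (𝟙_ C))
    (growth : CategoryHasModerateGrowth k C) {X Y : C} (hX : IsNonNegligible X)
    (hY : IsNonNegligible Y) {f : (toNullQuotient C).obj X ⟶ (toNullQuotient C).obj Y}
    (hf : f ≠ 0) : ∃ e : X ≅ Y, (toNullQuotient C).map e.hom = f := by
  obtain ⟨f, rfl⟩ := (toNullQuotient C).map_surjective f
  have := isIso_of_not_isNull finite_hom end_unit hX.1 hY.1 (growth X hX.1)
    (f := f) (fun h => hf ((toNullQuotient_map_eq_zero_iff f).mpr h))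
  exact ⟨asIso f, rfl⟩

/-- The quotient by the null morphisms is semisimple, with the images of the non-negligible objects
as simple objects. -/
theorem isSemisimpleClass [HasZeroObject C] (finite_hom : ∀ X Y : C, Module.Finite k (X ⟶ Y))
    (end_unit : Function.Bijective fun c : k => c • 𝟙 (𝟙_ C))
    (growth : CategoryHasModerateGrowth k C) :
    IsSemisimpleClass (FromNonNegligible (C := C)) where
  id_ne_zero := by
    rintro S ⟨X, hX, ⟨e⟩⟩ h
    have h1 : IsZero ((toNullQuotient C).obj X) :=
      ((IsZero.iff_id_eq_zero S).mpr h).of_iso e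
    exact ((isNonNegligible_iff end_unit).mp hX).2 (isZero_map_iff.mp h1)
  isIso := by
    rintro S T ⟨X, hX, ⟨e⟩⟩ ⟨Y, hY, ⟨e'⟩⟩ f hf
    have hne : e.hom ≫ f ≫ e'.inv ≠ 0 := fun h => hf (by
      simpa using congrArg (fun x => e.inv ≫ x ≫ e'.hom) h)
    obtain ⟨g, hg⟩ := isIso_of_map_ne_zero finite_hom end_unit growth hX hY hne
    have : f = e.inv ≫ (toNullQuotient C).map g.hom ≫ e'.hom := by simp [hg]
    rw [this]
    infer_instance
  decomposition := by
    suffices H : ∀ X : C, IsFiniteSum FromNonNegligible ((toNullQuotient C).obj X) from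
      fun X => H X.as
    intro X
    induction X using induction_indecomposable k finite_hom with
    | zero X hX => exact isFiniteSum_of_isZero ((toNullQuotient C).map_isZero hX)
    | indecomposable X hX =>
      by_cases h : IsNull (𝟙 X)
      · exact isFiniteSum_of_isZero (isZero_map_iff.mpr h)
      · exact isFiniteSum_of_mem ⟨X, (isNonNegligible_iff end_unit).mpr ⟨hX, h⟩, ⟨Iso.refl _⟩⟩
    | iso X Y e h => exact h.of_iso ((toNullQuotient C).mapIso e.symm)
    | sum X Y hX hY => exact (hX.biprod hY).of_iso (nonempty_map_biprod_iso X Y).some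

lemma isZigzag_id (finite_hom : ∀ X Y : C, Module.Finite k (X ⟶ Y))
    (end_unit : Function.Bijective fun c : k => c • 𝟙 (𝟙_ C))
    (growth : CategoryHasModerateGrowth k C) (X : C) :
    IsZigzag (𝟙 ((toNullQuotient C).obj X)) := by
  induction X using induction_indecomposable k finite_hom with
  | zero X hX =>
    rw [(IsZero.iff_id_eq_zero _).mp ((toNullQuotient C).map_isZero hX)]
    exact isZigzag_zero _
  | indecomposable X hX =>
    by_cases h : IsNull (𝟙 X)
    · rw [(IsZero.iff_id_eq_zero _).mp (isZero_map_iff.mpr h)]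
      exact isZigzag_zero _
    · obtain ⟨⟨X', ⟨_⟩⟩, -⟩ :=
        exists_exactPairing_and_isNull finite_hom end_unit hX h (growth X hX)
      have := BraidedCategory.exactPairing_swap X X'
      obtain ⟨Y, c, p, hz⟩ := isZigzag_id_of_exactPairing (X := X) (Y := X')
      exact ⟨(toNullQuotient C).obj Y, (toNullQuotient C).map c, (toNullQuotient C).map p,
        congrArg (toNullQuotient C).map hz⟩
  | iso X Y e h =>
    have := h.comp ((toNullQuotient C).map e.inv) ((toNullQuotient C).map e.hom)
    simpa [← Functor.map_comp] using this
  | sum X Y hX hY =>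
    have h1 := (hX.comp ((toNullQuotient C).map biprod.fst)
      ((toNullQuotient C).map biprod.inl)).add
      (hY.comp ((toNullQuotient C).map biprod.snd) ((toNullQuotient C).map biprod.inr))
    rwa [Category.id_comp, Category.id_comp, ← Functor.map_comp, ← Functor.map_comp,
      ← Functor.map_add, biprod.total, CategoryTheory.Functor.map_id] at h1

end Semisimple

section

variable {C : Type u} [Category.{v} C] [MonoidalCategory C]

lemma nonempty_tensorPower_iso {X Y : C} (e : X ≅ Y) (n : ℕ) :
    Nonempty (tensorPower X n ≅ tensorPower Y n) := by
  induction n with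
  | zero => exact ⟨Iso.refl _⟩
  | succ n ih => exact ⟨ih.some ⊗ᵢ e⟩

lemma hasModerateGrowth_of_iso {k : Type w} [Field k] [Preadditive C] [Linear k C] {X Y : C}
    (e : X ≅ Y) (h : HasModerateGrowth k X) : HasModerateGrowth k Y := by
  obtain ⟨n, hn⟩ := h
  obtain ⟨e⟩ := nonempty_tensorPower_iso e n
  exact ⟨n, by rwa [← (Linear.homCongr k e e).finrank_eq]⟩

/-- A braided monoidal category in which every object has an exact pairing is rigid. -/
lemma nonempty_rigidCategory [BraidedCategory C] (h : ∀ X : C, ∃ X', Nonempty (ExactPairing X X')) :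
    Nonempty (RigidCategory C) := by
  choose X' hX' using h
  let : RightRigidCategory C :=
    { rightDual := fun X => { rightDual := X' X, exact := (hX' X).some } }
  exact ⟨BraidedCategory.rigidCategoryOfRightRigidCategory⟩

variable [BraidedCategory C] [Preadditive C] [MonoidalPreadditive C]

lemma tensorPower_map (X : C) (n : ℕ) : tensorPower ((toNullQuotient C).obj X) n =
    (toNullQuotient C).obj (tensorPower X n) := by
  induction n with
  | zero => rfl
  | succ n ih =>
    change tensorPower _ n ⊗ _ = _
    rw [ih]
    rfl

variable {k : Type w} [Field k]
  [Linear k C] [MonoidalLinear k C]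

lemma end_unit_nullQuotient (end_unit : Function.Bijective fun c : k => c • 𝟙 (𝟙_ C)) :
    Function.Bijective fun c : k => c • 𝟙 (𝟙_ (NullQuotient C)) := by
  constructor
  · intro c d h
    apply end_unit.1
    have h : IsNull (c • 𝟙 (𝟙_ C) - d • 𝟙 (𝟙_ C)) :=
      (toNullQuotient_map_eq_iff (c • 𝟙 (𝟙_ C)) (d • 𝟙 (𝟙_ C))).mp h
    exact sub_eq_zero.mp h.eq_zero
  · rintro ⟨f⟩
    obtain ⟨c, rfl⟩ := end_unit.2 f
    exact ⟨c, rfl⟩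

lemma hasModerateGrowth_map (finite_hom : ∀ X Y : C, Module.Finite k (X ⟶ Y)) {X : C}
    (h : HasModerateGrowth k X) : HasModerateGrowth k ((toNullQuotient C).obj X) := by
  obtain ⟨n, hn⟩ := h
  refine ⟨n, lt_of_le_of_lt ?_ hn⟩
  rw [tensorPower_map]
  have := LinearMap.finrank_range_le ((toNullQuotient C).mapLinearMap k
    (X := tensorPower X n) (Y := tensorPower X n))
  rwa [LinearMap.range_eq_top.mpr (toNullQuotient C).map_surjective, finrank_top] at this

end

/-! ### Rings of isomorphism classes -/

section IsoClassRing

variable {C : Type u} [Category.{v} C] [MonoidalCategory C]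

lemma isoClass_eq_of_iso {X Y : C} (e : X ≅ Y) : isoClass X = isoClass Y :=
  congrArg (MonoidAlgebra.of ℤ (Skeleton C)) (congr_toSkeleton_of_iso e)

lemma isoClass_tensor (X Y : C) : isoClass (X ⊗ Y) = isoClass X * isoClass Y :=
  (congrArg (MonoidAlgebra.of ℤ (Skeleton C)) (Skeleton.toSkeleton_tensorObj X Y)).trans
    (map_mul _ _ _)

lemma isoClass_fromSkeleton (s : Skeleton C) :
    isoClass ((fromSkeleton C).obj s) = MonoidAlgebra.of ℤ (Skeleton C) s :=
  congrArg (MonoidAlgebra.of ℤ (Skeleton C)) (toSkeleton_fromSkeleton_obj s)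

lemma isoClassRing_induction {motive : IsoClassRing C → Prop} (x : IsoClassRing C)
    (isoClass : ∀ X : C, motive (isoClass X))
    (add : ∀ x y, motive x → motive y → motive (x + y))
    (zsmul : ∀ (n : ℤ) (x), motive x → motive (n • x)) : motive x :=
  MonoidAlgebra.induction_on x (fun s => isoClass_fromSkeleton s ▸ isoClass _) add zsmul

variable {D : Type u₁} [Category.{v₁} D] [MonoidalCategory D]

/-- The map on rings of isomorphism classes induced by a monoidal functor. -/
noncomputable def isoClassMap (F : C ⥤ D) [F.Monoidal] : IsoClassRing C →+* IsoClassRing D :=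
  MonoidAlgebra.mapDomainRingHom ℤ (Skeleton.monoidHom F)

lemma isoClassMap_isoClass (F : C ⥤ D) [F.Monoidal] (X : C) :
    isoClassMap F (isoClass X) = isoClass (F.obj X) := by
  refine (MonoidAlgebra.mapDomain_single ..).trans ?_
  exact congrArg (MonoidAlgebra.of ℤ (Skeleton D)) (F.mapSkeleton_obj_toSkeleton X)

lemma isoClassMap_surjective (F : C ⥤ D) [F.Monoidal] [F.EssSurj] :
    Function.Surjective (isoClassMap F) := by
  intro x
  induction x using isoClassRing_induction with
  | isoClass X => exact ⟨isoClass (F.objPreimage X),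
      (isoClassMap_isoClass F _).trans (isoClass_eq_of_iso (F.objObjPreimageIso X))⟩
  | add x y hx hy =>
    obtain ⟨x, rfl⟩ := hx
    obtain ⟨y, rfl⟩ := hy
    exact ⟨x + y, map_add _ _ _⟩
  | zsmul n x hx =>
    obtain ⟨x, rfl⟩ := hx
    exact ⟨n • x, map_zsmul _ _ _⟩

/-- The additive extension of `X ↦ dim Hom(T, X)` to the ring of isomorphism classes. -/
noncomputable def homDim (k : Type w) [Field k] [Preadditive C] [Linear k C] (T : C) :
    IsoClassRing C →+ ℤ :=
  MonoidAlgebra.liftNC (AddMonoidHom.id ℤ)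
    fun s => (Module.finrank k (T ⟶ (fromSkeleton C).obj s) : ℤ)

lemma homDim_isoClass (k : Type w) [Field k] [Preadditive C] [Linear k C] (T X : C) :
    homDim k T (isoClass X) = Module.finrank k (T ⟶ X) := by
  refine (MonoidAlgebra.liftNC_single _ _ _ _).trans ?_
  rw [AddMonoidHom.id_apply, one_mul,
    (Linear.homCongr k (Iso.refl T) (fromSkeletonToSkeletonIso X)).finrank_eq]

end IsoClassRing

lemma finrank_hom_eq_add_of_splitting {k : Type w} [Field k] {D : Type u} [Category.{v} D]
    [Preadditive D] [Linear k D] (finite_hom : ∀ X Y : D, Module.Finite k (X ⟶ Y))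
    {S : ShortComplex D} (s : S.Splitting) (T : D) : Module.finrank k (T ⟶ S.X₂) =
      Module.finrank k (T ⟶ S.X₁) + Module.finrank k (T ⟶ S.X₃) := by
  have e : (T ⟶ S.X₂) ≃ₗ[k] (T ⟶ S.X₁) × (T ⟶ S.X₃) :=
    LinearEquiv.ofLinearMap
      ((Linear.rightComp k T s.r).prod (Linear.rightComp k T S.g))
      ((Linear.rightComp k T S.f).coprod (Linear.rightComp k T s.s))
      (by ext <;> simp)
      (by ext x; simp [← Preadditive.comp_add, s.id])
  rw [e.finrank_eq, Module.finrank_prod]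

section GrothendieckRing

variable {D : Type u} [Category.{v} D] [Abelian D]

lemma nonempty_splitting (regular : ∀ {X Y : D} (f : X ⟶ Y), ∃ g, f ≫ g ≫ f = f)
    {S : ShortComplex D} (hS : S.ShortExact) : Nonempty S.Splitting := by
  obtain ⟨g, hg⟩ := regular S.f
  have := hS.mono_f
  have := hS.epi_g
  exact ⟨ShortComplex.Splitting.ofExactOfRetraction S hS.exact g
    (by rw [← cancel_mono S.f, Category.assoc, hg, Category.id_comp]) inferInstance⟩

variable [MonoidalCategory D]

/-- If all short exact sequences split, `dim Hom(T, -)` descends to the Grothendieck ring. -/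
lemma homDim_eq_zero_of_mem_span {k : Type w} [Field k] [Linear k D] [MonoidalPreadditive D]
    (finite_hom : ∀ X Y : D, Module.Finite k (X ⟶ Y))
    (regular : ∀ {X Y : D} (f : X ⟶ Y), ∃ g, f ≫ g ≫ f = f) (T : D) {x : IsoClassRing D}
    (hx : x ∈ Ideal.span (exactRelations D)) : homDim k T x = 0 := by
  -- the property has to be strengthened, to make it stable under multiplication
  suffices H : ∀ r, homDim k T (r * x) = 0 by simpa using H 1
  induction hx using Submodule.span_induction with
  | mem x hx =>
    obtain ⟨S, hS, rfl⟩ := hx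
    obtain ⟨s⟩ := nonempty_splitting regular hS
    intro r
    induction r using isoClassRing_induction with
    | isoClass Z =>
      have := finrank_hom_eq_add_of_splitting finite_hom (s.map (tensorLeft Z)) T
      simp only [mul_sub, ← isoClass_tensor, map_sub, homDim_isoClass]
      have h2 : (Module.finrank k (T ⟶ Z ⊗ S.X₂) : ℤ) =
        Module.finrank k (T ⟶ Z ⊗ S.X₁) + Module.finrank k (T ⟶ Z ⊗ S.X₃) := by exact_mod_cast this
      rw [h2]
      ring
    | add x y hx hy => rw [add_mul, map_add, hx, hy, add_zero]
    | zsmul n x hx => rw [smul_mul_assoc, map_zsmul, hx, smul_zero]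
  | zero => simp
  | add x y _ _ hx hy => intro r; rw [mul_add, map_add, hx, hy, add_zero]
  | smul a x _ hx => intro r; rw [smul_eq_mul, ← mul_assoc, hx]

variable [BraidedCategory D]

lemma GrothendieckRing.cls_eq_of_shortExact {S : ShortComplex D} (hS : S.ShortExact) :
    GrothendieckRing.cls S.X₂ = GrothendieckRing.cls S.X₁ + GrothendieckRing.cls S.X₃ := by
  rw [← sub_eq_zero, ← sub_sub]
  exact Ideal.Quotient.eq_zero_iff_mem.mpr (Ideal.subset_span ⟨S, hS, rfl⟩)

lemma GrothendieckRing.cls_eq_of_iso {X Y : D} (e : X ≅ Y) :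
    GrothendieckRing.cls X = GrothendieckRing.cls Y :=
  congrArg (Ideal.Quotient.mk _) (isoClass_eq_of_iso e)

lemma GrothendieckRing.cls_biprod [HasBinaryBiproducts D] (X Y : D) : GrothendieckRing.cls (X ⊞ Y) =
    GrothendieckRing.cls X + GrothendieckRing.cls Y :=
  cls_eq_of_shortExact (ShortComplex.Splitting.ofHasBinaryBiproduct X Y).shortExact

lemma GrothendieckRing.cls_eq_zero {X : D} (hX : IsZero X) : GrothendieckRing.cls X = 0 := by
  have := cls_eq_of_iso (show X ≅ X ⊞ X from
    hX.iso ((IsZero.iff_id_eq_zero _).mpr (by ext <;> exact hX.eq_of_src _ _)))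
  rwa [cls_biprod, left_eq_add] at this

end GrothendieckRing

section KRing

lemma IsNonNegligible.of_iso {C : Type u} [Category.{v} C] [MonoidalCategory C] [Preadditive C]
    [HasBinaryBiproducts C] {X Y : C} (h : IsNonNegligible X) (e : X ≅ Y) :
    IsNonNegligible Y := by
  obtain ⟨⟨hz, hi⟩, Z, ⟨r⟩⟩ := h
  exact ⟨⟨fun h => hz (h.of_iso e), fun A B e' => hi A B (e ≪≫ e')⟩, Z,
    ⟨r.trans (Retract.ofIso (whiskerLeftIso Z e))⟩⟩

variable {C : Type u} [Category.{v} C] [MonoidalCategory C] [BraidedCategory C] [Preadditive C]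
  [HasBinaryBiproducts C]

lemma KRing.cls_eq_of_iso {X Y : C} (e : X ≅ Y) : KRing.cls X = KRing.cls Y :=
  congrArg (Ideal.Quotient.mk _) (isoClass_eq_of_iso e)

lemma KRing.cls_biprod (X Y : C) : KRing.cls (X ⊞ Y) = KRing.cls X + KRing.cls Y := by
  rw [← sub_eq_zero, ← sub_sub]
  exact Ideal.Quotient.eq_zero_iff_mem.mpr (Ideal.subset_span (Or.inl ⟨X, Y, rfl⟩))

lemma KRing.cls_eq_zero_of_isNegligible {X : C} (h : IsNegligible X) : KRing.cls X = 0 :=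
  Ideal.Quotient.eq_zero_iff_mem.mpr (Ideal.subset_span (Or.inr ⟨X, h, rfl⟩))

lemma KRing.cls_eq_zero_of_isZero {X : C} (hX : IsZero X) : KRing.cls X = 0 := by
  have := cls_eq_of_iso (show X ≅ X ⊞ X from
    hX.iso ((IsZero.iff_id_eq_zero _).mpr (by ext <;> exact hX.eq_of_src _ _)))
  rwa [cls_biprod, left_eq_add] at this

/-- The classes of the non-negligible objects in `K(C)`. -/
noncomputable def nonNegligibleFamily (s : NonNegligibleClass C) : KRing C :=
  KRing.cls ((fromSkeleton C).obj s.1)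

lemma span_nonNegligibleFamily {k : Type w} [Field k] [Linear k C] [IsIdempotentComplete C]
    (finite_hom : ∀ X Y : C, Module.Finite k (X ⟶ Y)) :
    Submodule.span ℤ (Set.range (nonNegligibleFamily (C := C))) = ⊤ := by
  rw [eq_top_iff]
  rintro x -
  obtain ⟨x, rfl⟩ := Ideal.Quotient.mk_surjective x
  induction x using isoClassRing_induction with
  | isoClass X =>
    change KRing.cls X ∈ _
    induction X using induction_indecomposable k finite_hom with
    | zero X hX => rw [KRing.cls_eq_zero_of_isZero hX]; exact Submodule.zero_mem _
    | indecomposable X hX =>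
      by_cases h : IsNonNegligible X
      · let e := fromSkeletonToSkeletonIso X
        rw [← KRing.cls_eq_of_iso e]
        exact Submodule.subset_span ⟨⟨toSkeleton X, IsNonNegligible.of_iso h e.symm⟩, rfl⟩
      · rw [KRing.cls_eq_zero_of_isNegligible ⟨hX, h⟩]
        exact Submodule.zero_mem _
    | iso X Y e h => rwa [← KRing.cls_eq_of_iso e]
    | sum X Y hX hY => rw [KRing.cls_biprod]; exact Submodule.add_mem _ hX hY
  | add x y hx hy => rw [map_add]; exact Submodule.add_mem _ hx hy
  | zsmul n x hx => rw [map_zsmul]; exact Submodule.smul_mem _ n hx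

end KRing

/-! ### Comparison of `K(C)` with the Grothendieck ring -/

section Comparison

variable {C : Type u} [Category.{v} C] [MonoidalCategory C] [Preadditive C]
  [HasBinaryBiproducts C] {D : Type u₁} [Category.{v₁} D] [Abelian D] [MonoidalCategory D]
  [BraidedCategory D] (F : C ⥤ D) [F.Additive] [F.Monoidal]

lemma greenRelations_le_ker (isZero : ∀ X, IsNegligible X → IsZero (F.obj X)) :
    Ideal.span (greenRelations C) ≤ RingHom.ker
      ((Ideal.Quotient.mk (Ideal.span (exactRelations D))).comp (isoClassMap F)) := by
  rw [Ideal.span_le]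
  rintro x (⟨X, Y, rfl⟩ | ⟨X, hX, rfl⟩)
  · have s := (ShortComplex.Splitting.ofHasBinaryBiproduct X Y).map F
    have h := GrothendieckRing.cls_eq_of_shortExact s.shortExact
    rw [← sub_eq_zero, ← sub_sub] at h
    simpa [isoClassMap_isoClass, GrothendieckRing.cls] using h
  · have h := GrothendieckRing.cls_eq_zero (isZero X hX)
    simpa [isoClassMap_isoClass, GrothendieckRing.cls] using h

variable [BraidedCategory C]

/-- An additive monoidal functor to an abelian category that kills the negligible objects induces
a homomorphism from `K(C)` to the Grothendieck ring. -/
noncomputable def kRingMap (isZero : ∀ X, IsNegligible X → IsZero (F.obj X)) :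
    KRing C →+* GrothendieckRing D :=
  Ideal.Quotient.lift _ _ (greenRelations_le_ker F isZero)

variable {F}
  (isZero : ∀ X, IsNegligible X → IsZero (F.obj X))

lemma kRingMap_cls (X : C) :
    kRingMap F isZero (KRing.cls X) = GrothendieckRing.cls (F.obj X) :=
  congrArg (Ideal.Quotient.mk _) (isoClassMap_isoClass F X)

lemma kRingMap_surjective [F.EssSurj] : Function.Surjective (kRingMap F isZero) :=
  Ideal.Quotient.lift_surjective_of_surjective _ _
    (Ideal.Quotient.mk_surjective.comp (isoClassMap_surjective F))

/-- The functions `dim Hom(F(X), -)`, for `X` non-negligible, separate the classes of the objects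
`F(X)`. -/
lemma eq_zero_of_kRingMap_linearCombination {k : Type w} [Field k] [Linear k D]
    [MonoidalPreadditive D] (finite_hom : ∀ X Y : D, Module.Finite k (X ⟶ Y))
    (regular : ∀ {X Y : D} (f : X ⟶ Y), ∃ g, f ≫ g ≫ f = f)
    (id_ne_zero : ∀ X, IsNonNegligible X → 𝟙 (F.obj X) ≠ 0)
    (exists_iso : ∀ X Y, IsNonNegligible X → IsNonNegligible Y → ∀ f : F.obj X ⟶ F.obj Y,
      f ≠ 0 → Nonempty (X ≅ Y))
    (c : NonNegligibleClass C →₀ ℤ)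
    (hc : kRingMap F isZero (Finsupp.linearCombination ℤ nonNegligibleFamily c) = 0) : c = 0 := by
  let G : NonNegligibleClass C → D := fun s => F.obj ((fromSkeleton C).obj s.1)
  have h1 : kRingMap F isZero (Finsupp.linearCombination ℤ nonNegligibleFamily c) =
      Ideal.Quotient.mk _ (c.sum fun s n => n • isoClass (G s)) := by
    rw [Finsupp.linearCombination_apply, map_finsuppSum, map_finsuppSum]
    refine Finsupp.sum_congr fun s _ => ?_
    rw [map_zsmul, map_zsmul]
    exact congrArg _ (kRingMap_cls isZero _)
  rw [h1, Ideal.Quotient.eq_zero_iff_mem] at hc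
  ext t
  have h2 := homDim_eq_zero_of_mem_span (k := k) finite_hom regular (G t) hc
  have h3 (s : NonNegligibleClass C) (hs : s ≠ t) : Module.finrank k (G t ⟶ G s) = 0 := by
    have : Subsingleton (G t ⟶ G s) := subsingleton_of_forall_eq 0 fun f => by
      by_contra hf
      obtain ⟨e⟩ := exists_iso _ _ t.2 s.2 f hf
      exact hs (Subtype.ext (by
        rw [← toSkeleton_fromSkeleton_obj s.1, ← toSkeleton_fromSkeleton_obj t.1]
        exact congr_toSkeleton_of_iso e.symm))
    exact Module.finrank_zero_of_subsingleton
  have h4 : Module.finrank k (G t ⟶ G t) ≠ 0 := by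
    have := finite_hom (G t) (G t)
    have : Nontrivial (G t ⟶ G t) := ⟨⟨_, _, id_ne_zero _ t.2⟩⟩
    exact Module.finrank_pos.ne'
  rw [map_finsuppSum, Finsupp.sum_eq_single t (fun s _ hs => by
    rw [map_zsmul, homDim_isoClass, h3 s hs, Nat.cast_zero, smul_zero]) (fun _ => by simp),
    map_zsmul, homDim_isoClass, smul_eq_mul, mul_eq_zero] at h2
  exact h2.resolve_right (by exact_mod_cast h4)

end Comparison

end Semisimplification

open Semisimplification

theorem corollary1p7 {k : Type w} [Field k] [IsAlgClosed k]
    {C : Type u} [Category.{v} C] [Preadditive C] [Linear k C]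
    [HasZeroObject C] [HasBinaryBiproducts C] [IsIdempotentComplete C]
    [MonoidalCategory C] [BraidedCategory C] [MonoidalPreadditive C] [MonoidalLinear k C]
    (finite_hom : ∀ X Y : C, Module.Finite k (X ⟶ Y))
    (end_unit : Function.Bijective fun c : k => c • 𝟙 (𝟙_ C))
    (moderate : CategoryHasModerateGrowth k C) :
    -- a semisimplification `F : C ⥤ D` exists, and `D` has moderate growth
    ∃ (D : Type u) (_ : Category.{v} D) (_ : Abelian D) (_ : Linear k D)
      (_ : MonoidalCategory D) (_ : BraidedCategory D) (F : C ⥤ D) (_ : F.Braided),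
      IsSemisimplification k F ∧
      CategoryHasModerateGrowth k D ∧
      -- the simple objects of `D` are the images of the non-negligible objects, without repetition
      (∀ X : C, IsNonNegligible X → Simple (F.obj X)) ∧
      (∀ S : D, Simple S → ∃ X : C, IsNonNegligible X ∧ Nonempty (F.obj X ≅ S)) ∧
      (∀ X Y : C, IsNonNegligible X → IsNonNegligible Y →
        Nonempty (F.obj X ≅ F.obj Y) → Nonempty (X ≅ Y)) ∧
      -- the non-negligible objects form a `ℤ`-basis of `K(C)`
      (∃ b : Module.Basis (NonNegligibleClass C) ℤ (KRing C),
        ∀ s : NonNegligibleClass C, b s = KRing.cls ((fromSkeleton C).obj s.1)) ∧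
      -- `F` induces an isomorphism from `K(C)` to the Grothendieck ring of `D`
      (∃ e : KRing C ≃+* GrothendieckRing D,
        ∀ X : C, e (KRing.cls X) = GrothendieckRing.cls (F.obj X)) := by
  have hP := isSemisimpleClass finite_hom end_unit moderate
  have finite_hom' (X Y : NullQuotient C) : Module.Finite k (X ⟶ Y) :=
    have := finite_hom X.as Y.as
    Module.Finite.of_surjective ((toNullQuotient C).mapLinearMap k (X := X.as) (Y := Y.as))
      (toNullQuotient C).map_surjective
  have := hP.isIdempotentComplete
  have isZero (X : C) (hX : IsNegligible X) : IsZero ((toNullQuotient C).obj X) :=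
    isZero_map_iff.mpr (not_not.mp fun h =>
      hX.2 ((isNonNegligible_iff end_unit).mpr ⟨hX.1, h⟩))
  have regular {X Y : NullQuotient C} (f : X ⟶ Y) : ∃ g, f ≫ g ≫ f = f := hP.exists_regular f
  have fromNonNegligible {X : C} (hX : IsNonNegligible X) :
      FromNonNegligible ((toNullQuotient C).obj X) := ⟨X, hX, ⟨Iso.refl _⟩⟩
  have id_ne_zero (X : C) (hX : IsNonNegligible X) : 𝟙 ((toNullQuotient C).obj X) ≠ 0 :=
    hP.id_ne_zero (fromNonNegligible hX)
  have exists_iso (X Y : C) (hX : IsNonNegligible X) (hY : IsNonNegligible Y)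
      (f : (toNullQuotient C).obj X ⟶ (toNullQuotient C).obj Y) (hf : f ≠ 0) :
      Nonempty (X ≅ Y) := by
    obtain ⟨e, -⟩ := isIso_of_map_ne_zero finite_hom end_unit moderate hX hY hf
    exact ⟨e⟩
  let : Abelian (NullQuotient C) := hP.abelian
  have tensorCategory : IsSemisimpleTensorCategory k (NullQuotient C) :=
    { monoidalPreadditive := inferInstance
      monoidalLinear := inferInstance
      finite_hom := finite_hom'
      end_unit := end_unit_nullQuotient end_unit
      rigid := nonempty_rigidCategory fun X => by
        obtain ⟨Y, c, p, h⟩ := isZigzag_id finite_hom end_unit moderate X.as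
        exact exists_exactPairing_of_zigzag_eq_id c p h
      semisimple := fun X => by
        obtain ⟨n, S, hS, e⟩ := hP.decomposition X
        exact ⟨n, S, fun i => hP.simple (hS i), e⟩ }
  have injective := eq_zero_of_kRingMap_linearCombination isZero finite_hom' regular id_ne_zero
    exists_iso
  have hspan := span_nonNegligibleFamily finite_hom
  refine ⟨NullQuotient C, inferInstance, hP.abelian, inferInstance, inferInstance, inferInstance,
    toNullQuotient C, inferInstance, ?_, ?_, ?_, ?_, ?_, ?_, ?_⟩
  · exact
      { additive := inferInstance
        linear := inferInstance
        full := inferInstance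
        essSurj := inferInstance
        map_eq_zero_iff := fun f => (toNullQuotient_map_eq_zero_iff f).trans
          (isNegligibleMorphism_iff_isNull finite_hom end_unit moderate f).symm
        tensorCategory := tensorCategory }
  · intro Z hZ
    obtain ⟨T, ⟨X, hX, ⟨e⟩⟩, ⟨e'⟩⟩ := hP.exists_iso_of_indecomposable hZ
    exact hasModerateGrowth_of_iso (e ≪≫ e') (hasModerateGrowth_map finite_hom (moderate X hX.1))
  · exact fun X hX => hP.simple (fromNonNegligible hX)
  · intro S _
    obtain ⟨T, ⟨X, hX, ⟨e⟩⟩, ⟨e'⟩⟩ := hP.exists_iso_of_simple (S := S)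
    exact ⟨X, hX, ⟨e ≪≫ e'⟩⟩
  · rintro X Y hX hY ⟨e⟩
    exact exists_iso X Y hX hY e.hom fun h => id_ne_zero X hX (by
      rw [← e.hom_inv_id, h, zero_comp])
  · have li : LinearIndependent ℤ (nonNegligibleFamily (C := C)) :=
      linearIndependent_iff.mpr fun c hc => injective c (by rw [hc, map_zero])
    exact ⟨Module.Basis.mk li hspan.ge, fun s => Module.Basis.mk_apply li hspan.ge s⟩
  · refine ⟨RingEquiv.ofBijective (kRingMap (toNullQuotient C) isZero)
      ⟨(injective_iff_map_eq_zero _).mpr fun x hx => ?_, kRingMap_surjective isZero⟩,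
      fun X => kRingMap_cls isZero X⟩
    obtain ⟨c, rfl⟩ := Finsupp.mem_span_range_iff_exists_finsupp.mp
      (hspan.ge (Submodule.mem_top (x := x)))
    rw [injective c hx, Finsupp.sum_zero_index]
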